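/- \textbf{Theorem 1.} Let $U\subseteq\mathbb R^2$ be open, let $P_0,\dots,P_7:U\to\mathbb R$ be smooth functions of $(x,y)$, and consider the fourth-order ordinary differential equation $$y''''+P_7y'^7-P_6y'^6+P_5y'^5-P_4y'^4+P_3y'^3-P_2y'^2+P_1y'-P_0=0. \tag{A}$$ Define (real cube root; subscripts $x,y$ are partial derivatives) $$c=(P_7/15)^{1/3},\qquad g=\frac{P_6}{35c^2}-\frac{2c_y}{7c},$$ $$h=\frac{P_5}{27c^2}-\frac{26g^2}{27c}+\frac{c_x}{3c}-\frac{gc_y}{3c^2}-\frac{8g_y}{27c}-\frac{c_{yy}}{27c^2},$$ $$d=\frac{P_4}{21c^2}-\frac{38gh}{21c}-\frac{2g^3}{7c^2}+\frac{8gc_x}{21c^2}-\frac{8hc_y}{21c^2}+\frac{g_x}{3c}-\frac{gg_y}{3c^2}-\frac{2h_y}{7c}+\frac{2c_{xy}}{21c^2}-\frac{g_{yy}}{21c^2}.$$ Assume that on $U$: $c\neq0$; the four differential constraints $$\begin{aligned} P_3&=28cdg+13ch^2+12g^2h-7hc_x+7dc_y-6gg_x+6hg_y-5ch_x+5gh_y+4cd_y+c_{xx}-2g_{xy}+h_{yy},\\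 P_2&=18chd+8g^2d+7gh^2-6dc_x-5hg_x+5dg_y-4gh_x+4hh_y-3cd_x+3gd_y+g_{xx}-2h_{xy}+d_{yy},\\ P_1&=6cd^2+8ghd+h^3-4dg_x-3hh_x+3dh_y-2gd_x+2hd_y+h_{xx}-2d_{xy},\\ P_0&=2gd^2+h^2d-2dh_x-hd_x+dd_y+d_{xx} \end{aligned}$$ hold; and the Lie--Tresse criteria hold: $$\begin{aligned} 3(ch)_x+3dc_y+6cd_y-2gg_x-gh_y-3c_{xx}-2g_{xy}-h_{yy}&=0,\\ 3(dg)_y+3cd_x+6dc_x-2hh_y-hg_x-3d_{yy}-2h_{xy}-g_{xx}&=0. \end{aligned}$$ Then the following hold. (1) Equation (A) is conditionally linearizable, with root equation $$y''+cy'^3-gy'^2+hy'-d=0. \tag{B}$$ That is: (A) is obtained from (B) by differentiating twice with respect to $x$ and eliminating $y''$ by means of (B) after each differentiation; every ($C^2$) solution of (B) is $C^4$ and solves (A); and near every point of $U$ there is a smooth invertible point transformation $(x,y)\mapsto(X,Y)$ that carries (B) to the linear equation $d^2Y/dX^2=0$. (2) Over no nonempty open subset of $U$ is the left-hand side of (A)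 the total derivative $d\Phi/dx$ of a differentiable function $\Phi(x,y,y',y'',y''')$. (3) Near every point of $U$ there are smooth functions $a,b,e,f$ with $h=a-2e$, $g=f-2b$, and a smooth nondegenerate metric $p\,dx^2+2q\,dx\,dy+r\,dy^2$, such that $\Gamma^1_{11}=-a$, $\Gamma^1_{12}=-b$, $\Gamma^1_{22}=-c$, $\Gamma^2_{11}=-d$, $\Gamma^2_{12}=-e$, $\Gamma^2_{22}=-f$ are the Christoffel symbols of this metric and the metric is flat. -/

import Mathlib

open scoped ContDiff

noncomputable section

namespace CondLin

/-- Partial derivative `∂f/∂x` of a function of `(x, y)`. -/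
def dx (f : ℝ × ℝ → ℝ) (z : ℝ × ℝ) : ℝ := fderiv ℝ f z (1, 0)

/-- Partial derivative `∂f/∂y` of a function of `(x, y)`. -/
def dy (f : ℝ × ℝ → ℝ) (z : ℝ × ℝ) : ℝ := fderiv ℝ f z (0, 1)

/-- Total derivative `F_x + p F_y + q F_p` of a function `F (x, y) p` of `x`, `y` and `p = y'`,
where `q` stands for `y''`. -/
def totalDeriv (F : ℝ × ℝ → ℝ → ℝ) (z : ℝ × ℝ) (p q : ℝ) : ℝ :=
  dx (fun w => F w p) z + p * dy (fun w => F w p) z + q * deriv (F z) p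

/-- The total derivative of `F (x, y) y'` after replacing `y''` by `Q (x, y) y'`. -/
def totalDerivAlong (Q F : ℝ × ℝ → ℝ → ℝ) (z : ℝ × ℝ) (p : ℝ) : ℝ :=
  totalDeriv F z p (Q z p)

/-- The real cube root, also for negative arguments. -/
def cbrt (t : ℝ) : ℝ := Real.sign t * |t| ^ (1 / 3 : ℝ)

/-! ### The fourth-order equation and the identification of the root coefficients -/

/-- The polynomial `P₇ p⁷ - P₆ p⁶ + P₅ p⁵ - P₄ p⁴ + P₃ p³ - P₂ p² + P₁ p - P₀`; the fourth-order
equation is `y'''' + septic P (x, y) y' = 0`. -/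
def septic (P : Fin 8 → ℝ × ℝ → ℝ) (z : ℝ × ℝ) (p : ℝ) : ℝ :=
  P 7 z * p ^ 7 - P 6 z * p ^ 6 + P 5 z * p ^ 5 - P 4 z * p ^ 4
    + P 3 z * p ^ 3 - P 2 z * p ^ 2 + P 1 z * p - P 0 z

def coeffC (P : Fin 8 → ℝ × ℝ → ℝ) (z : ℝ × ℝ) : ℝ := cbrt (P 7 z / 15)

def coeffG (P : Fin 8 → ℝ × ℝ → ℝ) (z : ℝ × ℝ) : ℝ :=
  let c := coeffC P
  P 6 z / (35 * c z ^ 2) - 2 * dy c z / (7 * c z)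

def coeffH (P : Fin 8 → ℝ × ℝ → ℝ) (z : ℝ × ℝ) : ℝ :=
  let c := coeffC P
  let g := coeffG P
  P 5 z / (27 * c z ^ 2) - 26 * g z ^ 2 / (27 * c z) + dx c z / (3 * c z)
    - g z * dy c z / (3 * c z ^ 2) - 8 * dy g z / (27 * c z) - dy (dy c) z / (27 * c z ^ 2)

def coeffD (P : Fin 8 → ℝ × ℝ → ℝ) (z : ℝ × ℝ) : ℝ :=
  let c := coeffC P
  let g := coeffG P
  let h := coeffH P
  P 4 z / (21 * c z ^ 2) - 38 * g z * h z / (21 * c z) - 2 * g z ^ 3 / (7 * c z ^ 2)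
    + 8 * g z * dx c z / (21 * c z ^ 2) - 8 * h z * dy c z / (21 * c z ^ 2)
    + dx g z / (3 * c z) - g z * dy g z / (3 * c z ^ 2) - 2 * dy h z / (7 * c z)
    + 2 * dx (dy c) z / (21 * c z ^ 2) - dy (dy g) z / (21 * c z ^ 2)

/-- The differential constraints on `P₃`, `P₂`, `P₁`, `P₀` at the point `z`. -/
def Constraints (P : Fin 8 → ℝ × ℝ → ℝ) (c g h d : ℝ × ℝ → ℝ) (z : ℝ × ℝ) : Prop :=
  P 3 z = 28 * c z * d z * g z + 13 * c z * h z ^ 2 + 12 * g z ^ 2 * h z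
      - 7 * h z * dx c z + 7 * d z * dy c z - 6 * g z * dx g z + 6 * h z * dy g z
      - 5 * c z * dx h z + 5 * g z * dy h z + 4 * c z * dy d z
      + dx (dx c) z - 2 * dx (dy g) z + dy (dy h) z ∧
  P 2 z = 18 * c z * h z * d z + 8 * g z ^ 2 * d z + 7 * g z * h z ^ 2
      - 6 * d z * dx c z - 5 * h z * dx g z + 5 * d z * dy g z - 4 * g z * dx h z
      + 4 * h z * dy h z - 3 * c z * dx d z + 3 * g z * dy d z
      + dx (dx g) z - 2 * dx (dy h) z + dy (dy d) z ∧
  P 1 z = 6 * c z * d z ^ 2 + 8 * g z * h z * d z + h z ^ 3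
      - 4 * d z * dx g z - 3 * h z * dx h z + 3 * d z * dy h z - 2 * g z * dx d z
      + 2 * h z * dy d z + dx (dx h) z - 2 * dx (dy d) z ∧
  P 0 z = 2 * g z * d z ^ 2 + h z ^ 2 * d z - 2 * d z * dx h z - h z * dx d z
      + d z * dy d z + dx (dx d) z

/-- The Lie–Tresse conditions at the point `z` for the equation
`y'' + c y'³ - g y'² + h y' - d = 0`. -/
def LieTresse (c g h d : ℝ × ℝ → ℝ) (z : ℝ × ℝ) : Prop :=
  3 * dx (fun w => c w * h w) z + 3 * d z * dy c z + 6 * c z * dy d z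
      - 2 * g z * dx g z - g z * dy h z
      - 3 * dx (dx c) z - 2 * dx (dy g) z - dy (dy h) z = 0 ∧
  3 * dy (fun w => d w * g w) z + 3 * c z * dx d z + 6 * d z * dx c z
      - 2 * h z * dy h z - h z * dx g z
      - 3 * dy (dy d) z - 2 * dx (dy h) z - dx (dx g) z = 0

/-! ### Root equation, linearizability, conditional linearizability -/

/-- Right-hand side of the root equation `y'' = -c y'³ + g y'² - h y' + d`. -/
def rootRHS (c g h d : ℝ × ℝ → ℝ) (z : ℝ × ℝ) (p : ℝ) : ℝ :=
  -(c z) * p ^ 3 + g z * p ^ 2 - h z * p + d z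

/-- `y` is a classical solution of order `n` on the open set `I`, with graph in `U`, of
`y⁽ⁿ⁾ = F (x, y) y'`. -/
def IsSolution (n : ℕ) (U : Set (ℝ × ℝ)) (F : ℝ × ℝ → ℝ → ℝ) (I : Set ℝ) (y : ℝ → ℝ) : Prop :=
  IsOpen I ∧ ContDiffOn ℝ n y I ∧
    ∀ x ∈ I, (x, y x) ∈ U ∧ iteratedDeriv n y x = F (x, y x) (deriv y x)

/-- `dX/dx` along a curve of slope `p`. -/
def slopeDeriv (X : ℝ × ℝ → ℝ) (z : ℝ × ℝ) (p : ℝ) : ℝ := dx X z + p * dy X z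

/-- The transformed first derivative `dY/dX` as a function of `x`, `y`, `y'`. -/
def newFirst (X Y : ℝ × ℝ → ℝ) (z : ℝ × ℝ) (p : ℝ) : ℝ := slopeDeriv Y z p / slopeDeriv X z p

/-- The transformed second derivative `d²Y/dX²` as a function of `x`, `y`, `y'`, `y''`. -/
def newSecond (X Y : ℝ × ℝ → ℝ) (z : ℝ × ℝ) (p q : ℝ) : ℝ :=
  totalDeriv (newFirst X Y) z p q / slopeDeriv X z p

/-- `y'' = Q (x, y) y'` is linearizable near `z₀` by an invertible point transformation
`(x, y) ↦ (X, Y)`: in the new variables it is the linear equation `d²Y/dX² = 0` (to which every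
linear second-order equation is locally equivalent). -/
def LinearizableAt (U : Set (ℝ × ℝ)) (Q : ℝ × ℝ → ℝ → ℝ) (z₀ : ℝ × ℝ) : Prop :=
  ∃ (V : Set (ℝ × ℝ)) (X Y : ℝ × ℝ → ℝ),
    IsOpen V ∧ z₀ ∈ V ∧ V ⊆ U ∧ ContDiffOn ℝ ∞ X V ∧ ContDiffOn ℝ ∞ Y V ∧
    Set.InjOn (fun z => (X z, Y z)) V ∧
    (∀ z ∈ V, dx X z * dy Y z - dy X z * dx Y z ≠ 0) ∧
    ∀ z ∈ V, ∀ p q : ℝ, slopeDeriv X z p ≠ 0 → (q = Q z p ↔ newSecond X Y z p q = 0)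

/-- The equation `y'''' = F (x, y) y'` is linearizable on `U` conditionally on the root equation
`y'' = Q (x, y) y'`: it is obtained from the root equation by differentiating twice and
eliminating `y''` after each differentiation, every solution of the root equation solves it, and
the root equation is linearizable near every point. -/
def ConditionallyLinearizable (U : Set (ℝ × ℝ)) (F Q : ℝ × ℝ → ℝ → ℝ) : Prop :=
  (∀ z ∈ U, ∀ p : ℝ, F z p = totalDerivAlong Q (totalDerivAlong Q Q) z p) ∧
  (∀ (I : Set ℝ) (y : ℝ → ℝ), IsSolution 2 U Q I y → IsSolution 4 U F I y) ∧
  ∀ z ∈ U, LinearizableAt U Q z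

/-- `y'''' + G (x, y) y'` is a total derivative over `V`: it equals `dΦ/dx` for some function
`Φ (x, y, y', y'', y''')`, identically in `x, y, y', y'', y''', y''''`. -/
def IsTotalDerivativeOn (V : Set (ℝ × ℝ)) (G : ℝ × ℝ → ℝ → ℝ) : Prop :=
  ∃ Φ : ℝ × ℝ × ℝ × ℝ × ℝ → ℝ,
    DifferentiableOn ℝ Φ {w | (w.1, w.2.1) ∈ V} ∧
    ∀ x y p q r s : ℝ, (x, y) ∈ V →
      fderiv ℝ Φ (x, y, p, q, r) (1, p, q, r, s) = s + G (x, y) p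

/-! ### The associated flat metric -/

/-- Vanishing at `z` of the curvature of the connection with `Γ¹₁₁ = -a`, `Γ¹₁₂ = -b`,
`Γ¹₂₂ = -c`, `Γ²₁₁ = -d`, `Γ²₁₂ = -e`, `Γ²₂₂ = -f`. -/
def FlatChristoffel (a b c d e f : ℝ × ℝ → ℝ) (z : ℝ × ℝ) : Prop :=
  dy a z - dx b z + b z * e z - c z * d z = 0 ∧
  dy b z - dx c z + (a z * c z - b z ^ 2) + (b z * f z - c z * e z) = 0 ∧
  dy d z - dx e z - (a z * e z - b z * d z) - (d z * f z - e z ^ 2) = 0 ∧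
  dx (fun w => b w + f w) z = dy (fun w => a w + e w) z

/-- At `z`, the connection above is the Levi-Civita connection of the metric
`p dx² + 2 q dx dy + r dy²`. -/
def MetricCompatible (a b c d e f p q r : ℝ × ℝ → ℝ) (z : ℝ × ℝ) : Prop :=
  p z * r z - q z ^ 2 ≠ 0 ∧
  dx p z = -2 * (a z * p z + d z * q z) ∧
  dx q z = -(b z * p z) - (a z + e z) * q z - d z * r z ∧
  dx r z = -2 * (b z * q z + e z * r z) ∧
  dy p z = -2 * (b z * p z + e z * q z) ∧
  dy q z = -(c z * p z) - (b z + f z) * q z - e z * r z ∧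
  dy r z = -2 * (c z * q z + f z * r z)

/-- Near `z₀` the coefficients `c, g, h, d` come, through `h = a - 2e` and `g = f - 2b`, from the
Christoffel symbols of a flat nondegenerate metric. -/
def HasFlatMetricAt (U : Set (ℝ × ℝ)) (c g h d : ℝ × ℝ → ℝ) (z₀ : ℝ × ℝ) : Prop :=
  ∃ (V : Set (ℝ × ℝ)) (a b e f p q r : ℝ × ℝ → ℝ),
    IsOpen V ∧ z₀ ∈ V ∧ V ⊆ U ∧
    ContDiffOn ℝ ∞ a V ∧ ContDiffOn ℝ ∞ b V ∧ ContDiffOn ℝ ∞ e V ∧ ContDiffOn ℝ ∞ f V ∧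
    ContDiffOn ℝ ∞ p V ∧ ContDiffOn ℝ ∞ q V ∧ ContDiffOn ℝ ∞ r V ∧
    ∀ z ∈ V, h z = a z - 2 * e z ∧ g z = f z - 2 * b z ∧
      FlatChristoffel a b c d e f z ∧ MetricCompatible a b c d e f p q r z

end CondLin

end

/-! Assertion (1) has an algebraic half and a geometric half. Differentiating (B) twice along itself
gives a polynomial of degree seven in y'. The formulas for c, g, h, d are the identities between the
coefficients of y'^7, ..., y'^4 solved one after another, and the differential constraints are the
four remaining identities (`totalDerivAlong_totalDerivAlong_rootRHS`). Solutions of (B) gain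
regularity from the equation itself.

For the geometric half, (B) describes the unparametrized geodesics of a projective class of
connections, and the Lie–Tresse conditions say that this class is flat. The linear system
`ProjectiveHessian` for one function w makes this concrete: as a first-order system for (w, w_x,
w_y), its curvature consists of multiples of the two Lie–Tresse expressions. The Frobenius theorem
(`exists_parallel_section`) then yields three independent solutions w₀, w₁, w₂ near each point. The
quotients X = w₁/w₀ and Y = w₂/w₀ are affine functions for one connection of the class, whose
symbols involve the logarithmic derivatives of w₀ (`isAffineFunctionAt_div`). In these coordinates
geodesics are straight lines, so (B) becomes d²Y/dX² = 0 (`newSecond_eq`), and dX² + dY² is the flat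
metric of (3).

For (2), a potential Φ must be y''' plus a function of fewer variables. Eliminating y''', y'', y' in
turn leaves the total derivative of a function of (x, y), which is affine in y'. The coefficient P₇
≠ 0 forbids this. -/

open scoped ContDiff

noncomputable section

namespace CondLin

open Set Metric Filter Topology

/-! ### Linear ordinary differential equations on short intervals -/

section LinearODE

variable {E : Type*} [NormedAddCommGroup E] [NormedSpace ℝ E]

/-- A two-sided Grönwall type bound on a short interval. -/
theorem norm_le_of_norm_deriv_le {f f' : ℝ → E} {t₀ ε M κ : ℝ} (hε : 0 < ε) (hM : 0 ≤ M)
    (hMε : 2 * M * ε ≤ 1) (hκ : 0 ≤ κ)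
    (hf : ∀ t ∈ Icc (t₀ - ε) (t₀ + ε), HasDerivWithinAt f (f' t) (Icc (t₀ - ε) (t₀ + ε)) t)
    (hb : ∀ t ∈ Icc (t₀ - ε) (t₀ + ε), ‖f' t‖ ≤ M * ‖f t‖ + κ) :
    ∀ t ∈ Icc (t₀ - ε) (t₀ + ε), ‖f t‖ ≤ 2 * (‖f t₀‖ + ε * κ) := by
  have hcont : ContinuousOn f (Icc (t₀ - ε) (t₀ + ε)) := fun t ht => (hf t ht).continuousWithinAt
  have h0 : t₀ ∈ Icc (t₀ - ε) (t₀ + ε) := ⟨by linarith, by linarith⟩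
  -- At a maximum point `s` of the norm, the mean value inequality gives ‖f s‖ ≤ ‖f t₀‖ + ε(M‖f s‖ +
  -- κ). Since Mε ≤ 1/2, half of the left side absorbs the term in M.
  obtain ⟨s, hs, hmax⟩ := isCompact_Icc.exists_isMaxOn ⟨t₀, h0⟩ hcont.norm
  have hmax' : ∀ t ∈ Icc (t₀ - ε) (t₀ + ε), ‖f t‖ ≤ ‖f s‖ := fun t ht => hmax ht
  have hmv := (convex_Icc (t₀ - ε) (t₀ + ε)).norm_image_sub_le_of_norm_hasDerivWithin_le hf
    (C := M * ‖f s‖ + κ)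
    (fun t ht => (hb t ht).trans (by gcongr; exact hmax' t ht)) h0 hs
  have hdist : ‖s - t₀‖ ≤ ε := by
    rw [Real.norm_eq_abs, abs_le]
    exact ⟨by linarith [hs.1], by linarith [hs.2]⟩
  have h1 : ‖f s‖ ≤ ‖f t₀‖ + (M * ‖f s‖ + κ) * ε := by
    have h2 := norm_le_norm_sub_add (f s) (f t₀)
    have h3 : (M * ‖f s‖ + κ) * ‖s - t₀‖ ≤ (M * ‖f s‖ + κ) * ε := by gcongr
    linarith
  have h4 : 2 * M * ε * ‖f s‖ ≤ 1 * ‖f s‖ := by gcongr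
  intro t ht
  have := hmax' t ht
  nlinarith

/-- Existence for linear ordinary differential equations on a short interval whose length does
not depend on the initial value. -/
theorem exists_linear_ode_solution [CompleteSpace E] {L : ℝ → E →L[ℝ] E} {t₀ ε M : ℝ} (hε : 0 < ε)
    (hMε : 2 * M * ε ≤ 1)
    (hL : ContinuousOn L (Icc (t₀ - ε) (t₀ + ε)))
    (hb : ∀ t ∈ Icc (t₀ - ε) (t₀ + ε), ‖L t‖ ≤ M) (v : E) :
    ∃ f : ℝ → E, f t₀ = v ∧
      ∀ t ∈ Icc (t₀ - ε) (t₀ + ε), HasDerivWithinAt f (L t (f t)) (Icc (t₀ - ε) (t₀ + ε)) t := by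
  have h0 : t₀ ∈ Icc (t₀ - ε) (t₀ + ε) := ⟨by linarith, by linarith⟩
  have hM : 0 ≤ M := (norm_nonneg _).trans (hb t₀ h0)
  obtain ⟨m, rfl⟩ : ∃ m : NNReal, (m : ℝ) = M := ⟨⟨M, hM⟩, rfl⟩
  -- On the ball of radius ‖v‖ + 1 about `v` the speed is at most M(2‖v‖ + 1). As Mε ≤ 1/2, the
  -- solution cannot leave this ball in time ε, whatever `v` is.
  have hpl : IsPicardLindelof (fun t w => L t w) (⟨t₀, h0⟩ : Icc (t₀ - ε) (t₀ + ε)) v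
      (‖v‖₊ + 1) 0 (m * (2 * ‖v‖₊ + 1)) m := by
    refine ⟨fun t ht => ?_, fun w _ => ?_, fun t ht w hw => ?_, ?_⟩
    · exact ((L t).lipschitz.weaken (hb t ht)).lipschitzOnWith
    · exact hL.clm_apply continuousOn_const
    · have hw' : ‖w‖ ≤ 2 * ‖v‖ + 1 := by
        rw [mem_closedBall_iff_norm] at hw
        have := norm_le_norm_sub_add w v
        simp at hw
        linarith
      calc ‖L t w‖ ≤ ‖L t‖ * ‖w‖ := (L t).le_opNorm w
        _ ≤ m * (2 * ‖v‖ + 1) := by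
          have := hb t ht
          gcongr
        _ = _ := by simp
    · have h1 : max (t₀ + ε - t₀) (t₀ - (t₀ - ε)) = ε := by simp
      simp only [h1]
      have h2 : 2 * m * ε * (2 * ‖v‖ + 1) ≤ 1 * (2 * ‖v‖ + 1) := by gcongr
      have : m * (2 * ‖v‖ + 1) * ε ≤ ‖v‖ + 1 := by nlinarith [norm_nonneg v]
      simpa using this
  exact hpl.exists_eq_forall_mem_Icc_hasDerivWithinAt₀

end LinearODE

/-! ### Flat linear systems on a square, with quantitative bounds -/

section Frobenius

variable {E : Type*} [NormedAddCommGroup E] [NormedSpace ℝ E] [CompleteSpace E]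

/-- Integrability of a flat linear system on a small square, with explicit bounds. -/
theorem exists_parallel_section_on_square {A B Bx Ay : ℝ × ℝ → E →L[ℝ] E} {x₀ y₀ ε M N N' : ℝ}
    (hε : 0 < ε) (hM : 0 ≤ M) (hN : 0 ≤ N) (hN' : 0 ≤ N') (hMε : 2 * M * ε ≤ 1)
    (hAc : ContinuousOn A (Icc (x₀ - ε) (x₀ + ε) ×ˢ Icc (y₀ - ε) (y₀ + ε)))
    (hBc : ContinuousOn B (Icc (x₀ - ε) (x₀ + ε) ×ˢ Icc (y₀ - ε) (y₀ + ε)))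
    (hA : ∀ x ∈ Icc (x₀ - ε) (x₀ + ε), ∀ y ∈ Icc (y₀ - ε) (y₀ + ε), ‖A (x, y)‖ ≤ M)
    (hB : ∀ x ∈ Icc (x₀ - ε) (x₀ + ε), ∀ y ∈ Icc (y₀ - ε) (y₀ + ε), ‖B (x, y)‖ ≤ M)
    (hBx : ∀ x ∈ Icc (x₀ - ε) (x₀ + ε), ∀ y ∈ Icc (y₀ - ε) (y₀ + ε), ‖Bx (x, y)‖ ≤ N)
    (hBlip : ∀ x ∈ Icc (x₀ - ε) (x₀ + ε), ∀ x' ∈ Icc (x₀ - ε) (x₀ + ε),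
      ∀ y ∈ Icc (y₀ - ε) (y₀ + ε), ‖B (x', y) - B (x, y)‖ ≤ N * |x' - x|)
    (hBtaylor : ∀ x ∈ Icc (x₀ - ε) (x₀ + ε), ∀ x' ∈ Icc (x₀ - ε) (x₀ + ε),
      ∀ y ∈ Icc (y₀ - ε) (y₀ + ε),
      ‖B (x', y) - B (x, y) - (x' - x) • Bx (x, y)‖ ≤ N' * |x' - x| ^ 2)
    (hAy : ∀ x ∈ Icc (x₀ - ε) (x₀ + ε), ∀ y ∈ Icc (y₀ - ε) (y₀ + ε),
      HasDerivAt (fun t => A (x, t)) (Ay (x, y)) y)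
    (hflat : ∀ x ∈ Icc (x₀ - ε) (x₀ + ε), ∀ y ∈ Icc (y₀ - ε) (y₀ + ε),
      Ay (x, y) + A (x, y) ∘L B (x, y) = Bx (x, y) + B (x, y) ∘L A (x, y)) (v : E) :
    ∃ ψ : ℝ × ℝ → E, ψ (x₀, y₀) = v ∧
      ∀ x ∈ Ioo (x₀ - ε) (x₀ + ε), ∀ y ∈ Ioo (y₀ - ε) (y₀ + ε),
        HasFDerivAt ψ ((ContinuousLinearMap.toSpanSingleton ℝ (A (x, y) (ψ (x, y)))).coprod
          (ContinuousLinearMap.toSpanSingleton ℝ (B (x, y) (ψ (x, y))))) (x, y) := by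
  set I := Icc (x₀ - ε) (x₀ + ε) with hI
  set J := Icc (y₀ - ε) (y₀ + ε) with hJ
  have hx0 : x₀ ∈ I := ⟨by linarith, by linarith⟩
  have hy0 : y₀ ∈ J := ⟨by linarith, by linarith⟩
  -- Transport `v` along the horizontal line through y₀, then along every vertical line. The
  -- equation in y holds by construction; the equation in x is what flatness must supply.
  obtain ⟨φ, hφ0, hφ⟩ := exists_linear_ode_solution (L := fun t => A (t, y₀)) hε hMε
    (hAc.comp (by fun_prop) fun t ht => ⟨ht, hy0⟩) (fun t ht => hA t ht y₀ hy0) v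
  have hex : ∀ x : ℝ, ∃ f : ℝ → E, x ∈ I → f y₀ = φ x ∧
      ∀ t ∈ J, HasDerivWithinAt f (B (x, t) (f t)) J t := by
    intro x
    by_cases hx : x ∈ I
    · obtain ⟨f, hf⟩ := exists_linear_ode_solution (L := fun t => B (x, t)) hε hMε
        (hBc.comp (by fun_prop) fun t ht => ⟨hx, ht⟩) (fun t ht => hB x hx t ht) (φ x)
      exact ⟨f, fun _ => hf⟩
    · exact ⟨0, fun h => absurd h hx⟩
  choose ψ hψ using hex
  have hψ0 : ∀ x ∈ I, ψ x y₀ = φ x := fun x hx => (hψ x hx).1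
  have hψ' : ∀ x ∈ I, ∀ t ∈ J, HasDerivWithinAt (ψ x) (B (x, t) (ψ x t)) J t :=
    fun x hx => (hψ x hx).2
  have hφb : ∀ x ∈ I, ‖φ x‖ ≤ 2 * ‖v‖ := by
    intro x hx
    have := norm_le_of_norm_deriv_le (κ := 0) hε hM hMε le_rfl hφ
      (fun t ht => by simpa using (A (t, y₀)).le_of_opNorm_le (hA t ht y₀ hy0) (φ t)) x hx
    simpa [hφ0] using this
  -- Each of the two transports at most doubles the norm.
  set C := 4 * ‖v‖ with hC
  have hC0 : 0 ≤ C := by positivity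
  have hψb : ∀ x ∈ I, ∀ y ∈ J, ‖ψ x y‖ ≤ C := by
    intro x hx y hy
    have := norm_le_of_norm_deriv_le (κ := 0) hε hM hMε le_rfl (hψ' x hx)
      (fun t ht => by simpa using (B (x, t)).le_of_opNorm_le (hB x hx t ht) (ψ x t)) y hy
    rw [hψ0 x hx] at this
    linarith [hφb x hx]
  have hφlip : ∀ x ∈ I, ∀ x' ∈ I, ‖φ x' - φ x‖ ≤ M * C * |x' - x| := by
    intro x hx x' hx'
    refine (convex_Icc _ _).norm_image_sub_le_of_norm_hasDerivWithin_le hφ (fun t ht => ?_) hx hx'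
    refine ((A (t, y₀)).le_of_opNorm_le (hA t ht y₀ hy0) (φ t)).trans ?_
    have := hφb t ht
    gcongr
    linarith [norm_nonneg v]
  -- The difference of two vertical solutions solves the vertical equation up to a source of size N
  -- C |x' - x|, with initial value at most M C |x' - x|.
  set C' := 2 * (M * C + ε * (N * C)) with hC'
  have hC'0 : 0 ≤ C' := by positivity
  have hψlip : ∀ x ∈ I, ∀ x' ∈ I, ∀ y ∈ J, ‖ψ x' y - ψ x y‖ ≤ C' * |x' - x| := by
    intro x hx x' hx' y hy
    have := norm_le_of_norm_deriv_le (κ := N * C * |x' - x|) hε hM hMε (by positivity)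
      (fun t ht => (hψ' x' hx' t ht).sub (hψ' x hx t ht)) (fun t ht => ?_) y hy
    · simp only [Pi.sub_apply, hψ0 x hx, hψ0 x' hx'] at this
      refine this.trans ?_
      have := hφlip x hx x' hx'
      rw [hC']
      linarith
    · have h1 : B (x', t) (ψ x' t) - B (x, t) (ψ x t)
          = B (x', t) ((ψ x' - ψ x) t) + (B (x', t) - B (x, t)) (ψ x t) := by
        simp
      rw [h1]
      refine (norm_add_le _ _).trans (add_le_add ?_ ?_)
      · exact (B (x', t)).le_of_opNorm_le (hB x' hx' t ht) _
      · refine ((B (x', t) - B (x, t)).le_of_opNorm_le (hBlip x hx x' hx' t ht) _).trans ?_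
        have := hψb x hx t ht
        calc N * |x' - x| * ‖ψ x t‖ ≤ N * |x' - x| * C := by gcongr
          _ = N * C * |x' - x| := by ring
  set D := N' * C + N * C' with hD
  have hD0 : 0 ≤ D := by positivity
  -- By flatness, the first-order remainder in x again solves the vertical equation with coefficient
  -- B(x, ·), up to a quadratic source. In `D`, the term N' C bounds the Taylor remainder of B, and
  -- N C' bounds Bx applied to the increment of ψ. So smallness of the remainder propagates from the
  -- line y = y₀, where φ satisfies its equation.
  have hrem : ∀ x ∈ I, ∀ x' ∈ I, ∀ y ∈ J,
      ‖ψ x' y - ψ x y - (x' - x) • A (x, y) (ψ x y)‖ ≤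
        2 * (‖φ x' - φ x - (x' - x) • A (x, y₀) (φ x)‖ + ε * (D * |x' - x| ^ 2)) := by
    intro x hx x' hx' y hy
    have hd : ∀ t ∈ J, HasDerivWithinAt
        (fun t => ψ x' t - ψ x t - (x' - x) • A (x, t) (ψ x t))
        (B (x', t) (ψ x' t) - B (x, t) (ψ x t)
          - (x' - x) • (Ay (x, t) (ψ x t) + A (x, t) (B (x, t) (ψ x t)))) J t := fun t ht =>
      ((hψ' x' hx' t ht).sub (hψ' x hx t ht)).sub
        (((hAy x hx t ht).hasDerivWithinAt.clm_apply (hψ' x hx t ht)).const_smul (x' - x))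
    have := norm_le_of_norm_deriv_le (κ := D * |x' - x| ^ 2) hε hM hMε (by positivity) hd
      (fun t ht => ?_) y hy
    · simpa only [hψ0 x hx, hψ0 x' hx'] using this
    · have hfl := congrArg (fun T : E →L[ℝ] E => T (ψ x t)) (hflat x hx t ht)
      simp only [add_apply, ContinuousLinearMap.comp_apply] at hfl
      rw [hfl]
      have h1 : B (x', t) (ψ x' t) - B (x, t) (ψ x t)
            - (x' - x) • (Bx (x, t) (ψ x t) + B (x, t) (A (x, t) (ψ x t)))
          = B (x, t) (ψ x' t - ψ x t - (x' - x) • A (x, t) (ψ x t))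
            + ((B (x', t) - B (x, t) - (x' - x) • Bx (x, t)) (ψ x' t)
              + (x' - x) • Bx (x, t) (ψ x' t - ψ x t)) := by
        simp only [map_sub, map_smul, sub_apply,
          smul_apply, smul_add, smul_sub]
        abel
      rw [h1]
      refine (norm_add_le _ _).trans (add_le_add ?_ ((norm_add_le _ _).trans ?_))
      · exact (B (x, t)).le_of_opNorm_le (hB x hx t ht) _
      · have h2 : ‖(B (x', t) - B (x, t) - (x' - x) • Bx (x, t)) (ψ x' t)‖
            ≤ N' * |x' - x| ^ 2 * C := by
          refine (ContinuousLinearMap.le_of_opNorm_le _ (hBtaylor x hx x' hx' t ht) _).trans ?_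
          have := hψb x' hx' t ht
          gcongr
        have h3 : ‖(x' - x) • Bx (x, t) (ψ x' t - ψ x t)‖
            ≤ |x' - x| * (N * (C' * |x' - x|)) := by
          rw [norm_smul, Real.norm_eq_abs]
          have h4 := (Bx (x, t)).le_of_opNorm_le (hBx x hx t ht) (ψ x' t - ψ x t)
          have h5 := hψlip x hx x' hx' t ht
          gcongr
          exact h4.trans (by gcongr)
        rw [hD]
        nlinarith
  have hmemI : ∀ x ∈ Ioo (x₀ - ε) (x₀ + ε), I ∈ 𝓝 x := fun x hx => Icc_mem_nhds hx.1 hx.2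
  have hmemJ : ∀ y ∈ Ioo (y₀ - ε) (y₀ + ε), J ∈ 𝓝 y := fun y hy => Icc_mem_nhds hy.1 hy.2
  have hderx : ∀ x ∈ Ioo (x₀ - ε) (x₀ + ε), ∀ y ∈ Ioo (y₀ - ε) (y₀ + ε),
      HasDerivAt (fun t => ψ t y) (A (x, y) (ψ x y)) x := by
    intro x hx y hy
    have hxI := Ioo_subset_Icc_self hx
    have hyJ := Ioo_subset_Icc_self hy
    have hφd : HasDerivAt φ (A (x, y₀) (φ x)) x := (hφ x hxI).hasDerivAt (hmemI x hx)
    rw [hasDerivAt_iff_isLittleO] at hφd ⊢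
    have hsq : (fun x' : ℝ => |x' - x| ^ 2) =o[𝓝 x] fun x' => x' - x := by
      have h1 : (fun x' : ℝ => x' - x) =o[𝓝 x] fun _ => (1 : ℝ) := by
        rw [Asymptotics.isLittleO_one_iff]
        have : ContinuousAt (fun x' : ℝ => x' - x) x := by fun_prop
        simpa [ContinuousAt] using this
      have h2 := h1.mul_isBigO (Asymptotics.isBigO_refl (fun x' : ℝ => x' - x) (𝓝 x))
      simpa [sq_abs, sq] using h2
    have hsum := ((hφd.norm_left).add ((hsq.const_mul_left D).const_mul_left ε)).const_mul_left 2
    refine (Asymptotics.IsBigO.of_bound 1 ?_).trans_isLittleO hsum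
    filter_upwards [hmemI x hx] with x' hx'
    have := hrem x hxI x' hx' y hyJ
    rw [one_mul]
    exact this.trans (le_abs_self _)
  have hdery : ∀ x ∈ Ioo (x₀ - ε) (x₀ + ε), ∀ y ∈ Ioo (y₀ - ε) (y₀ + ε),
      HasDerivAt (fun t => ψ x t) (B (x, y) (ψ x y)) y := fun x hx y hy =>
    (hψ' x (Ioo_subset_Icc_self hx) y (Ioo_subset_Icc_self hy)).hasDerivAt (hmemJ y hy)
  have hbox : ∀ x ∈ Ioo (x₀ - ε) (x₀ + ε), ∀ y ∈ Ioo (y₀ - ε) (y₀ + ε),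
      I ×ˢ J ∈ 𝓝 (x, y) := fun x hx y hy => prod_mem_nhds (hmemI x hx) (hmemJ y hy)
  -- Joint continuity comes from continuity in y and a Lipschitz bound in x uniform in y. It makes
  -- both partial derivatives continuous, whence total differentiability.
  have hψc : ContinuousOn (fun z : ℝ × ℝ => ψ z.1 z.2) (I ×ˢ J) := by
    have := continuousOn_prod_of_continuousOn_lipschitzOnWith (s := I) (t := J)
      (fun z : ℝ × ℝ => ψ z.1 z.2) ⟨C', hC'0⟩
      (fun x hx y hy => (hψ' x hx y hy).continuousWithinAt)
      (fun y hy => LipschitzOnWith.of_dist_le_mul fun x hx x' hx' => by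
        rw [dist_eq_norm, dist_eq_norm]; exact hψlip x' hx' x hx y hy)
    exact this
  refine ⟨fun z => ψ z.1 z.2, by simp [hψ0 x₀ hx0, hφ0], fun x hx y hy => ?_⟩
  have hev : ∀ᶠ w : ℝ × ℝ in 𝓝 (x, y),
      w.1 ∈ Ioo (x₀ - ε) (x₀ + ε) ∧ w.2 ∈ Ioo (y₀ - ε) (y₀ + ε) :=
    prod_mem_nhds (Ioo_mem_nhds hx.1 hx.2) (Ioo_mem_nhds hy.1 hy.2)
  have hspan : Continuous fun e : E => ContinuousLinearMap.toSpanSingleton ℝ e :=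
    (ContinuousLinearMap.toSpanSingletonCLE (𝕜 := ℝ) (E := E)).continuous
  exact (hasStrictFDerivAt_uncurry_coprod (f := ψ)
    (f₁ := fun x y => ContinuousLinearMap.toSpanSingleton ℝ (A (x, y) (ψ x y)))
    (f₂ := fun x y => ContinuousLinearMap.toSpanSingleton ℝ (B (x, y) (ψ x y)))
    (u := (x, y))
    (hev.mono fun w hw => (hderx w.1 hw.1 w.2 hw.2).hasFDerivAt)
    (hev.mono fun w hw => (hdery w.1 hw.1 w.2 hw.2).hasFDerivAt)
    (hspan.continuousAt.comp ((hAc.clm_apply hψc).continuousAt (hbox x hx y hy)))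
    (hspan.continuousAt.comp ((hBc.clm_apply hψc).continuousAt (hbox x hx y hy)))).hasFDerivAt

end Frobenius

/-! ### The Frobenius theorem for smooth coefficients, and in coordinates -/

section Frobenius

variable {E : Type*} [NormedAddCommGroup E] [NormedSpace ℝ E]

theorem hasDerivAt_fst_line {F : ℝ × ℝ → E} {x y : ℝ} (hF : DifferentiableAt ℝ F (x, y)) :
    HasDerivAt (fun t => F (t, y)) (fderiv ℝ F (x, y) (1, 0)) x :=
  hF.hasFDerivAt.comp_hasDerivAt x ((hasDerivAt_id x).prodMk (hasDerivAt_const x y))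

theorem hasDerivAt_snd_line {F : ℝ × ℝ → E} {x y : ℝ} (hF : DifferentiableAt ℝ F (x, y)) :
    HasDerivAt (fun t => F (x, t)) (fderiv ℝ F (x, y) (0, 1)) y :=
  hF.hasFDerivAt.comp_hasDerivAt y ((hasDerivAt_const y x).prodMk (hasDerivAt_id y))

/-- The derivative of a smooth map in a fixed direction is smooth. -/
theorem contDiffOn_fderiv_apply_const {G : Type*} [NormedAddCommGroup G] [NormedSpace ℝ G]
    {F : G → E} {U : Set G} (hU : IsOpen U) (hF : ContDiffOn ℝ ∞ F U) (w : G) :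
    ContDiffOn ℝ ∞ (fun z => fderiv ℝ F z w) U :=
  ((contDiffOn_infty_iff_fderiv_of_isOpen hU).1 hF).2.clm_apply contDiffOn_const

/-- A solution of a linear total differential equation with smooth coefficients is smooth. -/
theorem contDiffOn_of_hasFDerivAt_linear {A B : ℝ × ℝ → E →L[ℝ] E} {ψ : ℝ × ℝ → E}
    {V : Set (ℝ × ℝ)} (hV : IsOpen V) (hA : ContDiffOn ℝ ∞ A V) (hB : ContDiffOn ℝ ∞ B V)
    (hψ : ∀ z ∈ V, HasFDerivAt ψ ((ContinuousLinearMap.toSpanSingleton ℝ (A z (ψ z))).coprod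
          (ContinuousLinearMap.toSpanSingleton ℝ (B z (ψ z)))) z) :
    ContDiffOn ℝ ∞ ψ V := by
  rw [contDiffOn_infty]
  intro n
  -- Bootstrapping: the derivative of ψ is an expression in A, B and ψ, so it is as regular as ψ,
  -- which gains ψ one order.
  induction n with
  | zero => exact contDiffOn_zero.2 fun z hz => (hψ z hz).continuousAt.continuousWithinAt
  | succ n ih =>
    push_cast
    rw [contDiffOn_succ_iff_fderiv_of_isOpen hV]
    refine ⟨fun z hz => (hψ z hz).differentiableAt.differentiableWithinAt, by simp, ?_⟩
    have hn : (n : WithTop ℕ∞) ≤ ∞ := by exact_mod_cast le_top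
    have hs : ∀ {T : ℝ × ℝ → E →L[ℝ] E}, ContDiffOn ℝ ∞ T V →
        ContDiffOn ℝ n (fun z => ContinuousLinearMap.toSpanSingleton ℝ (T z (ψ z))) V :=
      fun hT => (ContinuousLinearMap.toSpanSingletonCLE (𝕜 := ℝ) (E := E)).contDiff.comp_contDiffOn
        ((hT.of_le hn).clm_apply ih)
    have h1 : ContDiffOn ℝ n (fun z =>
        (ContinuousLinearMap.toSpanSingleton ℝ (A z (ψ z))) ∘L ContinuousLinearMap.fst ℝ ℝ ℝ
        + (ContinuousLinearMap.toSpanSingleton ℝ (B z (ψ z))) ∘L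
            ContinuousLinearMap.snd ℝ ℝ ℝ) V :=
      ((hs hA).clm_comp contDiffOn_const).add ((hs hB).clm_comp contDiffOn_const)
    refine h1.congr fun z hz => ?_
    rw [(hψ z hz).fderiv]
    ext <;> simp

/-- **Frobenius theorem for linear systems in the plane**: a smooth linear system
`∂ψ/∂x = A ψ`, `∂ψ/∂y = B ψ` with vanishing curvature has a smooth local solution with any
prescribed value at a point. -/
theorem exists_parallel_section [CompleteSpace E] {A B : ℝ × ℝ → E →L[ℝ] E} {U : Set (ℝ × ℝ)}
    (hU : IsOpen U) (hA : ContDiffOn ℝ ∞ A U) (hB : ContDiffOn ℝ ∞ B U)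
    (hflat : ∀ z ∈ U, fderiv ℝ A z (0, 1) + A z ∘L B z = fderiv ℝ B z (1, 0) + B z ∘L A z)
    {z₀ : ℝ × ℝ} (hz₀ : z₀ ∈ U) (v : E) :
    ∃ V : Set (ℝ × ℝ), ∃ ψ : ℝ × ℝ → E, IsOpen V ∧ z₀ ∈ V ∧ V ⊆ U ∧ ContDiffOn ℝ ∞ ψ V ∧
      ψ z₀ = v ∧ ∀ z ∈ V, fderiv ℝ ψ z (1, 0) = A z (ψ z) ∧ fderiv ℝ ψ z (0, 1) = B z (ψ z) := by
  obtain ⟨x₀, y₀⟩ := z₀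
  obtain ⟨R, hR, hRU⟩ := nhds_basis_closedBall.mem_iff.1 (hU.mem_nhds hz₀)
  have hcpt := isCompact_closedBall (x₀, y₀) R
  set Bx : ℝ × ℝ → E →L[ℝ] E := fun z => fderiv ℝ B z (1, 0) with hBxdef
  have hBxs : ContDiffOn ℝ ∞ Bx U := contDiffOn_fderiv_apply_const hU hB (1, 0)
  have hBxxs : ContDiffOn ℝ ∞ (fun z => fderiv ℝ Bx z (1, 0)) U :=
    contDiffOn_fderiv_apply_const hU hBxs (1, 0)
  obtain ⟨M₁, hM₁⟩ := hcpt.exists_bound_of_continuousOn (hA.continuousOn.mono hRU)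
  obtain ⟨M₂, hM₂⟩ := hcpt.exists_bound_of_continuousOn (hB.continuousOn.mono hRU)
  obtain ⟨N₁, hN₁⟩ := hcpt.exists_bound_of_continuousOn (hBxs.continuousOn.mono hRU)
  obtain ⟨N₂, hN₂⟩ := hcpt.exists_bound_of_continuousOn (hBxxs.continuousOn.mono hRU)
  set M := max (max M₁ M₂) 0
  set N := max N₁ 0
  set N' := max N₂ 0
  have hM : 0 ≤ M := le_max_right _ _
  -- The `+ 1` covers M = 0 and still gives 2Mε ≤ 1.
  set ε := min R (1 / (2 * M + 1)) with hεdef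
  have hε : 0 < ε := lt_min hR (by positivity)
  have hMε : 2 * M * ε ≤ 1 := by
    have h1 : ε ≤ 1 / (2 * M + 1) := min_le_right _ _
    calc 2 * M * ε ≤ 2 * M * (1 / (2 * M + 1)) := by gcongr
      _ = 2 * M / (2 * M + 1) := by ring
      _ ≤ 1 := by rw [div_le_one (by positivity)]; linarith
  have hmem : ∀ x ∈ Icc (x₀ - ε) (x₀ + ε), ∀ y ∈ Icc (y₀ - ε) (y₀ + ε),
      (x, y) ∈ closedBall (x₀, y₀) R := by
    intro x hx y hy
    have h1 : ε ≤ R := min_le_left _ _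
    rw [← closedBall_prod_same, Real.closedBall_eq_Icc, Real.closedBall_eq_Icc]
    exact ⟨⟨by linarith [hx.1], by linarith [hx.2]⟩, ⟨by linarith [hy.1], by linarith [hy.2]⟩⟩
  have hmemU : ∀ x ∈ Icc (x₀ - ε) (x₀ + ε), ∀ y ∈ Icc (y₀ - ε) (y₀ + ε), (x, y) ∈ U :=
    fun x hx y hy => hRU (hmem x hx y hy)
  have hsub : Icc (x₀ - ε) (x₀ + ε) ×ˢ Icc (y₀ - ε) (y₀ + ε) ⊆ U :=
    fun z hz => hmemU z.1 hz.1 z.2 hz.2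
  have hdiff : ∀ {F : ℝ × ℝ → E →L[ℝ] E}, ContDiffOn ℝ ∞ F U → ∀ z ∈ U, DifferentiableAt ℝ F z :=
    fun hF z hz => (hF.contDiffAt (hU.mem_nhds hz)).differentiableAt (by simp)
  have hBd : ∀ x ∈ Icc (x₀ - ε) (x₀ + ε), ∀ y ∈ Icc (y₀ - ε) (y₀ + ε),
      HasDerivAt (fun t => B (t, y)) (Bx (x, y)) x := fun x hx y hy =>
    hasDerivAt_fst_line (hdiff hB _ (hmemU x hx y hy))
  have hBxd : ∀ x ∈ Icc (x₀ - ε) (x₀ + ε), ∀ y ∈ Icc (y₀ - ε) (y₀ + ε),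
      HasDerivAt (fun t => Bx (t, y)) (fderiv ℝ Bx (x, y) (1, 0)) x := fun x hx y hy =>
    hasDerivAt_fst_line (hdiff hBxs _ (hmemU x hx y hy))
  have hBxb : ∀ x ∈ Icc (x₀ - ε) (x₀ + ε), ∀ y ∈ Icc (y₀ - ε) (y₀ + ε), ‖Bx (x, y)‖ ≤ N :=
    fun x hx y hy => (hN₁ _ (hmem x hx y hy)).trans (le_max_left _ _)
  have hBlip : ∀ x ∈ Icc (x₀ - ε) (x₀ + ε), ∀ x' ∈ Icc (x₀ - ε) (x₀ + ε),
      ∀ y ∈ Icc (y₀ - ε) (y₀ + ε), ‖B (x', y) - B (x, y)‖ ≤ N * |x' - x| :=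
    fun x hx x' hx' y hy => (convex_Icc _ _).norm_image_sub_le_of_norm_hasDerivWithin_le
      (fun t ht => (hBd t ht y hy).hasDerivWithinAt) (fun t ht => hBxb t ht y hy) hx hx'
  have hBtaylor : ∀ x ∈ Icc (x₀ - ε) (x₀ + ε), ∀ x' ∈ Icc (x₀ - ε) (x₀ + ε),
      ∀ y ∈ Icc (y₀ - ε) (y₀ + ε),
      ‖B (x', y) - B (x, y) - (x' - x) • Bx (x, y)‖ ≤ N' * |x' - x| ^ 2 := by
    intro x hx x' hx' y hy
    have hss : uIcc x x' ⊆ Icc (x₀ - ε) (x₀ + ε) := (convex_Icc _ _).ordConnected.uIcc_subset hx hx'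
    -- The mean value inequality is applied to B minus its linear part at x; its derivative Bx(t, y)
    -- - Bx(x, y) is bounded by N'|x' - x| through the second x-derivative.
    have hmv := (convex_uIcc x x').norm_image_sub_le_of_norm_hasDerivWithin_le
      (f := fun t => B (t, y) - (t - x) • Bx (x, y)) (f' := fun t => Bx (t, y) - (1 : ℝ) • Bx (x, y))
      (C := N' * |x' - x|)
      (fun t ht => ((hBd t (hss ht) y hy).sub
        (((hasDerivAt_id t).sub_const x).smul_const (Bx (x, y)))).hasDerivWithinAt)
      (fun t ht => by
        rw [one_smul]
        have h1 : ‖Bx (t, y) - Bx (x, y)‖ ≤ N' * ‖t - x‖ :=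
          (convex_Icc _ _).norm_image_sub_le_of_norm_hasDerivWithin_le
            (fun s hs => (hBxd s hs y hy).hasDerivWithinAt)
            (fun s hs => (hN₂ _ (hmem s hs y hy)).trans (le_max_left _ _)) hx (hss ht)
        refine h1.trans ?_
        have h2 : |t - x| ≤ |x' - x| := abs_sub_left_of_mem_uIcc ht
        rw [Real.norm_eq_abs]
        have : 0 ≤ N' := le_max_right _ _
        gcongr)
      left_mem_uIcc right_mem_uIcc
    have h3 : B (x', y) - (x' - x) • Bx (x, y) - (B (x, y) - (x - x) • Bx (x, y))
        = B (x', y) - B (x, y) - (x' - x) • Bx (x, y) := by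
      rw [sub_self, zero_smul]; abel
    rw [h3, Real.norm_eq_abs] at hmv
    linarith
  obtain ⟨ψ, hψ0, hψ⟩ := exists_parallel_section_on_square (Bx := Bx)
    (Ay := fun z => fderiv ℝ A z (0, 1)) hε hM (le_max_right _ _) (le_max_right _ _) hMε
    (hA.continuousOn.mono hsub) (hB.continuousOn.mono hsub)
    (fun x hx y hy => (hM₁ _ (hmem x hx y hy)).trans ((le_max_left _ _).trans (le_max_left _ _)))
    (fun x hx y hy => (hM₂ _ (hmem x hx y hy)).trans ((le_max_right _ _).trans (le_max_left _ _)))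
    hBxb hBlip hBtaylor
    (fun x hx y hy => hasDerivAt_snd_line (hdiff hA _ (hmemU x hx y hy)))
    (fun x hx y hy => hflat _ (hmemU x hx y hy)) v
  have hVsub : Ioo (x₀ - ε) (x₀ + ε) ×ˢ Ioo (y₀ - ε) (y₀ + ε) ⊆ U :=
    (Set.prod_mono Ioo_subset_Icc_self Ioo_subset_Icc_self).trans hsub
  have hVopen : IsOpen (Ioo (x₀ - ε) (x₀ + ε) ×ˢ Ioo (y₀ - ε) (y₀ + ε)) := isOpen_Ioo.prod isOpen_Ioo
  refine ⟨_, ψ, hVopen, ⟨⟨by simpa, by simpa⟩, ⟨by simpa, by simpa⟩⟩, hVsub,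
    contDiffOn_of_hasFDerivAt_linear hVopen (hA.mono hVsub) (hB.mono hVsub)
      (fun z hz => hψ z.1 hz.1 z.2 hz.2), hψ0, fun z hz => ?_⟩
  rw [(hψ z.1 hz.1 z.2 hz.2).fderiv]
  simp

/-- The Frobenius theorem for linear systems in the plane in coordinates. -/
theorem exists_parallel_coordinates {n : ℕ} {a b : Fin n → Fin n → ℝ × ℝ → ℝ} {U : Set (ℝ × ℝ)}
    (hU : IsOpen U) (ha : ∀ i j, ContDiffOn ℝ ∞ (a i j) U) (hb : ∀ i j, ContDiffOn ℝ ∞ (b i j) U)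
    (hflat : ∀ z ∈ U, ∀ i j, dy (a i j) z + ∑ k, a i k z * b k j z
      = dx (b i j) z + ∑ k, b i k z * a k j z)
    {z₀ : ℝ × ℝ} (hz₀ : z₀ ∈ U) (v : Fin n → ℝ) :
    ∃ V : Set (ℝ × ℝ), ∃ ψ : Fin n → ℝ × ℝ → ℝ, IsOpen V ∧ z₀ ∈ V ∧ V ⊆ U ∧
      (∀ i, ContDiffOn ℝ ∞ (ψ i) V) ∧ (∀ i, ψ i z₀ = v i) ∧
      ∀ z ∈ V, ∀ i, dx (ψ i) z = ∑ k, a i k z * ψ k z ∧ dy (ψ i) z = ∑ k, b i k z * ψ k z := by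
  let T : (Fin n → Fin n → ℝ) →ₗ[ℝ] ((Fin n → ℝ) →L[ℝ] (Fin n → ℝ)) :=
    (LinearMap.toContinuousLinearMap : ((Fin n → ℝ) →ₗ[ℝ] (Fin n → ℝ)) ≃ₗ[ℝ] _).toLinearMap ∘ₗ
      (Matrix.toLin' : Matrix (Fin n) (Fin n) ℝ ≃ₗ[ℝ] _).toLinearMap
  have hT : ∀ m w i, T m w i = ∑ k, m i k * w k := fun m w i => rfl
  let T' := LinearMap.toContinuousLinearMap T
  have hT' : ∀ m, T' m = T m := fun m => rfl
  have hsm : ∀ {m : Fin n → Fin n → ℝ × ℝ → ℝ}, (∀ i j, ContDiffOn ℝ ∞ (m i j) U) →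
      ContDiffOn ℝ ∞ (fun z i j => m i j z) U := fun hm =>
    contDiffOn_pi.2 fun i => contDiffOn_pi.2 fun j => hm i j
  have hder : ∀ {m : Fin n → Fin n → ℝ × ℝ → ℝ}, (∀ i j, ContDiffOn ℝ ∞ (m i j) U) →
      ∀ z ∈ U, ∀ w, fderiv ℝ (fun z => T' (fun i j => m i j z)) z w
        = T fun i j => fderiv ℝ (m i j) z w := by
    intro m hm z hz w
    have h1 : HasFDerivAt (fun z i j => m i j z)
        (ContinuousLinearMap.pi fun i => ContinuousLinearMap.pi fun j => fderiv ℝ (m i j) z) z :=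
      hasFDerivAt_pi.2 fun i => hasFDerivAt_pi.2 fun j =>
        (((hm i j).contDiffAt (hU.mem_nhds hz)).differentiableAt (by simp)).hasFDerivAt
    exact congrArg (fun S => S w) (T'.hasFDerivAt.comp z h1).fderiv
  obtain ⟨V, ψ, hV, hzV, hVU, hψ, hψ0, hψd⟩ := exists_parallel_section hU
    (T'.contDiff.comp_contDiffOn (hsm ha)) (T'.contDiff.comp_contDiffOn (hsm hb))
    (fun z hz => by
      have h1 := hder ha z hz (0, 1)
      have h2 := hder hb z hz (1, 0)
      simp only [Function.comp_def] at h1 h2 ⊢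
      rw [h1, h2]
      ext w i
      have h3 : ∀ (m m' : Fin n → Fin n → ℝ) (w i),
          (T' m ∘L T' m') w i = ∑ j, (∑ k, m i k * m' k j) * w j := by
        intro m m' w i
        simp only [hT', ContinuousLinearMap.comp_apply, hT, Finset.mul_sum, Finset.sum_mul]
        rw [Finset.sum_comm]
        simp only [mul_assoc]
      simp only [add_apply, Pi.add_apply, h3, hT, ← Finset.sum_add_distrib, ← add_mul]
      refine Finset.sum_congr rfl fun j _ => ?_
      rw [show fderiv ℝ (a i j) z (0, 1) = dy (a i j) z from rfl,
        show fderiv ℝ (b i j) z (1, 0) = dx (b i j) z from rfl, hflat z hz i j]) hz₀ v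
  have hψi : ∀ z ∈ V, ∀ i w, fderiv ℝ (fun z => ψ z i) z w = fderiv ℝ ψ z w i := by
    intro z hz i w
    rw [fderiv_apply ((hψ.contDiffAt (hV.mem_nhds hz)).differentiableAt (by simp))]
    rfl
  refine ⟨V, fun i z => ψ z i, hV, hzV, hVU, fun i => contDiffOn_pi.1 hψ i,
    fun i => congrFun hψ0 i, fun z hz i => ⟨?_, ?_⟩⟩
  · simp only [dx, hψi z hz, (hψd z hz).1]
    exact hT _ _ _
  · simp only [dy, hψi z hz, (hψd z hz).2]
    exact hT _ _ _

end Frobenius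

/-! ### Calculus of the partial derivatives -/

section Calculus

variable {f g : ℝ × ℝ → ℝ} {z : ℝ × ℝ} {U : Set (ℝ × ℝ)}

theorem dx_const (r : ℝ) : dx (fun _ => r) z = 0 := by simp [dx]

theorem dy_const (r : ℝ) : dy (fun _ => r) z = 0 := by simp [dy]

theorem dx_add (hf : DifferentiableAt ℝ f z) (hg : DifferentiableAt ℝ g z) :
    dx (fun w => f w + g w) z = dx f z + dx g z := by
  simp [dx, fderiv_fun_add hf hg]

theorem dy_add (hf : DifferentiableAt ℝ f z) (hg : DifferentiableAt ℝ g z) :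
    dy (fun w => f w + g w) z = dy f z + dy g z := by
  simp [dy, fderiv_fun_add hf hg]

theorem dx_sub (hf : DifferentiableAt ℝ f z) (hg : DifferentiableAt ℝ g z) :
    dx (fun w => f w - g w) z = dx f z - dx g z := by
  simp [dx, fderiv_fun_sub hf hg]

theorem dy_sub (hf : DifferentiableAt ℝ f z) (hg : DifferentiableAt ℝ g z) :
    dy (fun w => f w - g w) z = dy f z - dy g z := by
  simp [dy, fderiv_fun_sub hf hg]

theorem dx_neg : dx (fun w => -f w) z = -dx f z := by
  simp [dx, fderiv_fun_neg]

theorem dy_neg : dy (fun w => -f w) z = -dy f z := by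
  simp [dy, fderiv_fun_neg]

theorem dx_mul (hf : DifferentiableAt ℝ f z) (hg : DifferentiableAt ℝ g z) :
    dx (fun w => f w * g w) z = dx f z * g z + f z * dx g z := by
  simp [dx, fderiv_fun_mul hf hg]; ring

theorem dy_mul (hf : DifferentiableAt ℝ f z) (hg : DifferentiableAt ℝ g z) :
    dy (fun w => f w * g w) z = dy f z * g z + f z * dy g z := by
  simp [dy, fderiv_fun_mul hf hg]; ring

theorem differentiableAt_div (hf : DifferentiableAt ℝ f z) (hg : DifferentiableAt ℝ g z)
    (h : g z ≠ 0) : DifferentiableAt ℝ (fun w => f w / g w) z := by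
  simp only [div_eq_mul_inv]
  exact hf.fun_mul (hg.fun_inv h)

theorem dx_div (hf : DifferentiableAt ℝ f z) (hg : DifferentiableAt ℝ g z) (h : g z ≠ 0) :
    dx (fun w => f w / g w) z = (dx f z * g z - f z * dx g z) / g z ^ 2 :=
  (hasDerivAt_fst_line (differentiableAt_div hf hg h)).unique
    ((hasDerivAt_fst_line hf).fun_div (hasDerivAt_fst_line hg) h)

theorem dy_div (hf : DifferentiableAt ℝ f z) (hg : DifferentiableAt ℝ g z) (h : g z ≠ 0) :
    dy (fun w => f w / g w) z = (dy f z * g z - f z * dy g z) / g z ^ 2 :=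
  (hasDerivAt_snd_line (differentiableAt_div hf hg h)).unique
    ((hasDerivAt_snd_line hf).fun_div (hasDerivAt_snd_line hg) h)

theorem dx_congr (hU : IsOpen U) (h : EqOn f g U) (hz : z ∈ U) : dx f z = dx g z := by
  rw [dx, dx, (h.eventuallyEq_of_mem (hU.mem_nhds hz)).fderiv_eq]

theorem dy_congr (hU : IsOpen U) (h : EqOn f g U) (hz : z ∈ U) : dy f z = dy g z := by
  rw [dy, dy, (h.eventuallyEq_of_mem (hU.mem_nhds hz)).fderiv_eq]

theorem contDiffOn_dx (hU : IsOpen U) (hf : ContDiffOn ℝ ∞ f U) : ContDiffOn ℝ ∞ (dx f) U :=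
  contDiffOn_fderiv_apply_const hU hf (1, 0)

theorem contDiffOn_dy (hU : IsOpen U) (hf : ContDiffOn ℝ ∞ f U) : ContDiffOn ℝ ∞ (dy f) U :=
  contDiffOn_fderiv_apply_const hU hf (0, 1)

theorem differentiableAt_of_contDiffOn (hU : IsOpen U) (hf : ContDiffOn ℝ ∞ f U) (hz : z ∈ U) :
    DifferentiableAt ℝ f z :=
  (hf.contDiffAt (hU.mem_nhds hz)).differentiableAt (by simp)

/-- Oriented as a rewriting rule: mixed derivatives are brought to the order used in `LieTresse` and
`Constraints`. -/
theorem dy_dx_comm (hU : IsOpen U) (hf : ContDiffOn ℝ ∞ f U) (hz : z ∈ U) :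
    dy (dx f) z = dx (dy f) z := by
  have hat := hf.contDiffAt (hU.mem_nhds hz)
  have h2 : ∀ n : ℕ, (n : WithTop ℕ∞) ≤ ∞ := fun n => by exact_mod_cast le_top
  have hsymm : IsSymmSndFDerivAt ℝ f z := hat.isSymmSndFDerivAt (by simpa using h2 2)
  have hd : DifferentiableAt ℝ (fderiv ℝ f) z :=
    (((contDiffOn_infty_iff_fderiv_of_isOpen hU).1 hf).2.contDiffAt
      (hU.mem_nhds hz)).differentiableAt (by simp)
  have key : ∀ v w : ℝ × ℝ, fderiv ℝ (fun z => fderiv ℝ f z v) z w = fderiv ℝ (fderiv ℝ f) z w v := by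
    intro v w
    rw [fderiv_clm_apply hd (by fun_prop)]
    simp
  change fderiv ℝ (fun z => fderiv ℝ f z (1, 0)) z (0, 1)
    = fderiv ℝ (fun z => fderiv ℝ f z (0, 1)) z (1, 0)
  rw [key, key]
  exact hsymm _ _

end Calculus

/-! ### The linear system attached to a cubic second-order equation -/

/-- The linear system of second order whose ratios of solutions linearize
`y'' + c y'³ - g y'² + h y' - d = 0`. -/
def ProjectiveHessian (c g h d w : ℝ × ℝ → ℝ) (z : ℝ × ℝ) : Prop :=
  dx (dx w) z = (dy d z + dx h z / 3 - 2 / 3 * (d z * g z) + 2 / 9 * (h z * h z)) * w z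
      - h z / 3 * dx w z - d z * dy w z ∧
  dx (dy w) z = (c z * d z - g z * h z / 9 - (dy h z + dx g z) / 3) * w z
      + g z / 3 * dx w z + h z / 3 * dy w z ∧
  dy (dy w) z = (dx c z + dy g z / 3 - 2 / 3 * (h z * c z) + 2 / 9 * (g z * g z)) * w z
      - c z * dx w z - g z / 3 * dy w z

/-- The system is prolonged to a first-order linear system for (w, w_x, w_y), so that Frobenius
applies and the 1-jet at a point can be prescribed. This is where the Lie–Tresse conditions enter.
-/
theorem exists_projectiveHessian_solution {U : Set (ℝ × ℝ)} (hU : IsOpen U)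
    {c g h d : ℝ × ℝ → ℝ} (hc : ContDiffOn ℝ ∞ c U) (hg : ContDiffOn ℝ ∞ g U)
    (hh : ContDiffOn ℝ ∞ h U) (hd : ContDiffOn ℝ ∞ d U)
    (hLT : ∀ z ∈ U, LieTresse c g h d z) {z₀ : ℝ × ℝ} (hz₀ : z₀ ∈ U) (v : Fin 3 → ℝ) :
    ∃ V : Set (ℝ × ℝ), ∃ w : ℝ × ℝ → ℝ, IsOpen V ∧ z₀ ∈ V ∧ V ⊆ U ∧ ContDiffOn ℝ ∞ w V ∧
      w z₀ = v 0 ∧ dx w z₀ = v 1 ∧ dy w z₀ = v 2 ∧ ∀ z ∈ V, ProjectiveHessian c g h d w z := by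
  have hcx := contDiffOn_dx hU hc
  have hgx := contDiffOn_dx hU hg
  have hgy := contDiffOn_dy hU hg
  have hhx := contDiffOn_dx hU hh
  have hhy := contDiffOn_dy hU hh
  have hdy := contDiffOn_dy hU hd
  -- The coefficients of w are forced: the curvature entries in the columns of w_x and w_y vanish
  -- for exactly these functions.
  let K₁ : ℝ × ℝ → ℝ := fun z => dy d z + dx h z / 3 - 2 / 3 * (d z * g z) + 2 / 9 * (h z * h z)
  let K₂ : ℝ × ℝ → ℝ := fun z => c z * d z - g z * h z / 9 - (dy h z + dx g z) / 3
  let K₃ : ℝ × ℝ → ℝ := fun z => dx c z + dy g z / 3 - 2 / 3 * (h z * c z) + 2 / 9 * (g z * g z)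
  have hK₁ : ContDiffOn ℝ ∞ K₁ U := by fun_prop
  have hK₂ : ContDiffOn ℝ ∞ K₂ U := by fun_prop
  have hK₃ : ContDiffOn ℝ ∞ K₃ U := by fun_prop
  let a : Fin 3 → Fin 3 → ℝ × ℝ → ℝ := ![![fun _ => 0, fun _ => 1, fun _ => 0],
    ![K₁, fun z => -(h z / 3), fun z => -d z], ![K₂, fun z => g z / 3, fun z => h z / 3]]
  let b : Fin 3 → Fin 3 → ℝ × ℝ → ℝ := ![![fun _ => 0, fun _ => 0, fun _ => 1],
    ![K₂, fun z => g z / 3, fun z => h z / 3], ![K₃, fun z => -c z, fun z => -(g z / 3)]]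
  obtain ⟨V, ψ, hV, hzV, hVU, hψ, hψ0, hψd⟩ := exists_parallel_coordinates (a := a) (b := b) hU
    (fun i j => by fin_cases i <;> fin_cases j <;> simp [a] <;> fun_prop)
    (fun i j => by fin_cases i <;> fin_cases j <;> simp [b] <;> fun_prop)
    (fun z hz => by
      obtain ⟨hL₁, hL₂⟩ := hLT z hz
      have hc' := differentiableAt_of_contDiffOn hU hc hz
      have hg' := differentiableAt_of_contDiffOn hU hg hz
      have hh' := differentiableAt_of_contDiffOn hU hh hz
      have hd' := differentiableAt_of_contDiffOn hU hd hz
      have hcx' := differentiableAt_of_contDiffOn hU hcx hz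
      have hgx' := differentiableAt_of_contDiffOn hU hgx hz
      have hgy' := differentiableAt_of_contDiffOn hU hgy hz
      have hhx' := differentiableAt_of_contDiffOn hU hhx hz
      have hhy' := differentiableAt_of_contDiffOn hU hhy hz
      have hdy' := differentiableAt_of_contDiffOn hU hdy hz
      have hsg := dy_dx_comm hU hg hz
      have hsh := dy_dx_comm hU hh hz
      have hK₁y : dy K₁ z = dy (dy d) z + dx (dy h) z / 3 - 2 / 3 * (dy d z * g z + d z * dy g z)
          + 4 / 9 * (h z * dy h z) := by
        simp only [K₁, div_eq_mul_inv]
        simp (disch := fun_prop) only [dy_add, dy_sub, dy_mul, dy_const, hsh]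
        ring
      have hK₂x : dx K₂ z = dx c z * d z + c z * dx d z - (dx g z * h z + g z * dx h z) / 9
          - (dx (dy h) z + dx (dx g) z) / 3 := by
        simp only [K₂, div_eq_mul_inv]
        simp (disch := fun_prop) only [dx_add, dx_sub, dx_mul, dx_const]
        ring
      have hK₂y : dy K₂ z = dy c z * d z + c z * dy d z - (dy g z * h z + g z * dy h z) / 9
          - (dy (dy h) z + dx (dy g) z) / 3 := by
        simp only [K₂, div_eq_mul_inv]
        simp (disch := fun_prop) only [dy_add, dy_sub, dy_mul, dy_const, hsg]
        ring
      have hK₃x : dx K₃ z = dx (dx c) z + dx (dy g) z / 3 - 2 / 3 * (dx h z * c z + h z * dx c z)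
          + 4 / 9 * (g z * dx g z) := by
        simp only [K₃, div_eq_mul_inv]
        simp (disch := fun_prop) only [dx_add, dx_sub, dx_mul, dx_const]
        ring
      rw [dx_mul hc' hh'] at hL₁
      rw [dy_mul hd' hg'] at hL₂
      have h1 : dx (fun z => h z / 3) z = dx h z / 3 := by
        simp (disch := fun_prop) only [div_eq_mul_inv, dx_mul, dx_const]; ring
      have h2 : dx (fun z => g z / 3) z = dx g z / 3 := by
        simp (disch := fun_prop) only [div_eq_mul_inv, dx_mul, dx_const]; ring
      have h3 : dy (fun z => h z / 3) z = dy h z / 3 := by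
        simp (disch := fun_prop) only [div_eq_mul_inv, dy_mul, dy_const]; ring
      have h4 : dy (fun z => g z / 3) z = dy g z / 3 := by
        simp (disch := fun_prop) only [div_eq_mul_inv, dy_mul, dy_const]; ring
      intro i j
      fin_cases i <;> fin_cases j <;>
        simp [a, b, Fin.sum_univ_three, dx_const, dy_const, dx_neg, dy_neg, hK₁y, hK₂x, hK₂y, hK₃x,
          h1, h2, h3, h4] <;> simp only [K₁, K₂, K₃]
      -- Only the entries in the column of w, in the rows of w_x and w_y, carry a condition: the
      -- second and the first Lie–Tresse equation.
      · linear_combination (-1 / 3 : ℝ) * hL₂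
      · ring
      · ring
      · linear_combination (1 / 3 : ℝ) * hL₁
      · ring
      · ring) hz₀ v
  have hx0 : EqOn (dx (ψ 0)) (ψ 1) V := fun z hz => by
    simpa [a, Fin.sum_univ_three] using (hψd z hz 0).1
  have hy0 : EqOn (dy (ψ 0)) (ψ 2) V := fun z hz => by
    simpa [b, Fin.sum_univ_three] using (hψd z hz 0).2
  refine ⟨V, ψ 0, hV, hzV, hVU, hψ 0, hψ0 0, by rw [hx0 hzV, hψ0], by rw [hy0 hzV, hψ0],
    fun z hz => ⟨?_, ?_, ?_⟩⟩
  · rw [dx_congr hV hx0 hz, hx0 hz, hy0 hz, (hψd z hz 1).1]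
    simp [a, Fin.sum_univ_three, K₁]
    ring
  · rw [dx_congr hV hy0 hz, hx0 hz, hy0 hz, (hψd z hz 2).1]
    simp [a, Fin.sum_univ_three, K₂]
  · rw [dy_congr hV hy0 hz, hx0 hz, hy0 hz, (hψd z hz 2).2]
    simp [b, Fin.sum_univ_three, K₃]
    ring

/-! ### Affine coordinates -/

/-- `X` has parallel differential at `z` for the connection with `Γ¹₁₁ = -a`, `Γ¹₁₂ = -b`,
`Γ¹₂₂ = -c`, `Γ²₁₁ = -d`, `Γ²₁₂ = -e`, `Γ²₂₂ = -f`. -/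
def IsAffineFunctionAt (a b c d e f X : ℝ × ℝ → ℝ) (z : ℝ × ℝ) : Prop :=
  dx (dx X) z = -(a z * dx X z) - d z * dy X z ∧
  dx (dy X) z = -(b z * dx X z) - e z * dy X z ∧
  dy (dy X) z = -(c z * dx X z) - f z * dy X z

section Quotient

variable {V : Set (ℝ × ℝ)} {c g h d w w₀ : ℝ × ℝ → ℝ} {z : ℝ × ℝ}

/-- In the second derivatives of a quotient of two solutions, the zeroth-order terms cancel. What
remains is the trace-free connection of the system, changed projectively by the logarithmic
differential of w₀; this keeps a - 2e = h and f - 2b = g. -/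
theorem isAffineFunctionAt_div (hV : IsOpen V) (hw : ContDiffOn ℝ ∞ w V)
    (hw₀ : ContDiffOn ℝ ∞ w₀ V) (hne : ∀ z ∈ V, w₀ z ≠ 0) (hz : z ∈ V)
    (hHw : ProjectiveHessian c g h d w z) (hHw₀ : ProjectiveHessian c g h d w₀ z) :
    IsAffineFunctionAt (fun z => h z + 2 * (dx w₀ z / w₀ z - h z / 3))
      (fun z => dy w₀ z / w₀ z - g z / 3) c d (fun z => dx w₀ z / w₀ z - h z / 3)
      (fun z => g z + 2 * (dy w₀ z / w₀ z - g z / 3)) (fun z => w z / w₀ z) z := by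
  have hd : ∀ {u : ℝ × ℝ → ℝ}, ContDiffOn ℝ ∞ u V → ∀ z ∈ V, DifferentiableAt ℝ u z :=
    fun hu z hz => differentiableAt_of_contDiffOn hV hu hz
  have hX : EqOn (dx fun z => w z / w₀ z)
      (fun z => (dx w z * w₀ z - w z * dx w₀ z) / (w₀ z * w₀ z)) V := fun z hz => by
    rw [dx_div (hd hw z hz) (hd hw₀ z hz) (hne z hz), sq]
  have hY : EqOn (dy fun z => w z / w₀ z)
      (fun z => (dy w z * w₀ z - w z * dy w₀ z) / (w₀ z * w₀ z)) V := fun z hz => by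
    rw [dy_div (hd hw z hz) (hd hw₀ z hz) (hne z hz), sq]
  obtain ⟨hw1, hw2, hw3⟩ := hHw
  obtain ⟨hv1, hv2, hv3⟩ := hHw₀
  have h0 := hne z hz
  have h00 : w₀ z * w₀ z ≠ 0 := mul_ne_zero h0 h0
  have h1 := hd hw z hz
  have h2 := hd hw₀ z hz
  have h3 := hd (contDiffOn_dx hV hw) z hz
  have h4 := hd (contDiffOn_dy hV hw) z hz
  have h5 := hd (contDiffOn_dx hV hw₀) z hz
  have h6 := hd (contDiffOn_dy hV hw₀) z hz
  refine ⟨?_, ?_, ?_⟩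
  · rw [dx_congr hV hX hz, hX hz, hY hz, dx_div (by fun_prop) (by fun_prop) h00]
    simp (disch := fun_prop) only [dx_sub, dx_mul, hw1, hv1]
    field_simp
    ring
  · rw [dx_congr hV hY hz, hX hz, hY hz, dx_div (by fun_prop) (by fun_prop) h00]
    simp (disch := fun_prop) only [dx_sub, dx_mul, hw2, hv2]
    field_simp
    ring
  · rw [dy_congr hV hY hz, hX hz, hY hz, dy_div (by fun_prop) (by fun_prop) h00]
    simp (disch := fun_prop) only [dy_sub, dy_mul, hw3, hv3]
    field_simp
    ring

/-- The system for w₀ replaces its second derivatives, and the curvature cancels. In the last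
equation, b + f and a + e are 3 w₀_y/w₀ and 3 w₀_x/w₀, so it is the symmetry of mixed derivatives of
log |w₀|. -/
theorem flatChristoffel_of_projectiveHessian (hV : IsOpen V) (hg : ContDiffOn ℝ ∞ g V)
    (hh : ContDiffOn ℝ ∞ h V) (hw₀ : ContDiffOn ℝ ∞ w₀ V) (hne : ∀ z ∈ V, w₀ z ≠ 0) (hz : z ∈ V)
    (hH : ProjectiveHessian c g h d w₀ z) :
    FlatChristoffel (fun z => h z + 2 * (dx w₀ z / w₀ z - h z / 3))
      (fun z => dy w₀ z / w₀ z - g z / 3) c d (fun z => dx w₀ z / w₀ z - h z / 3)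
      (fun z => g z + 2 * (dy w₀ z / w₀ z - g z / 3)) z := by
  have hd : ∀ {u : ℝ × ℝ → ℝ}, ContDiffOn ℝ ∞ u V → DifferentiableAt ℝ u z :=
    fun hu => differentiableAt_of_contDiffOn hV hu hz
  have h0 := hne z hz
  have hg' := hd hg
  have hh' := hd hh
  have h2 := hd hw₀
  have h5 := hd (contDiffOn_dx hV hw₀)
  have h6 := hd (contDiffOn_dy hV hw₀)
  have hcomm := dy_dx_comm hV hw₀ hz
  obtain ⟨hv1, hv2, hv3⟩ := hH
  have hx3 : ∀ {u : ℝ × ℝ → ℝ}, DifferentiableAt ℝ u z → dx (fun z => u z / 3) z = dx u z / 3 :=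
    fun hu => by simp (disch := fun_prop) only [div_eq_mul_inv, dx_mul, dx_const]; ring
  have hy3 : ∀ {u : ℝ × ℝ → ℝ}, DifferentiableAt ℝ u z → dy (fun z => u z / 3) z = dy u z / 3 :=
    fun hu => by simp (disch := fun_prop) only [div_eq_mul_inv, dy_mul, dy_const]; ring
  have hq1 : DifferentiableAt ℝ (fun z => dx w₀ z / w₀ z) z := differentiableAt_div h5 h2 h0
  have hq2 : DifferentiableAt ℝ (fun z => dy w₀ z / w₀ z) z := differentiableAt_div h6 h2 h0
  have hxx := dx_div h5 h2 h0
  have hxy := dx_div h6 h2 h0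
  have hyx := dy_div h5 h2 h0
  have hyy := dy_div h6 h2 h0
  rw [hv1] at hxx
  rw [hv2] at hxy
  rw [hcomm, hv2] at hyx
  rw [hv3] at hyy
  refine ⟨?_, ?_, ?_, ?_⟩ <;>
    simp (disch := fun_prop) only [dx_add, dx_sub, dx_mul, dx_const, dy_add, dy_sub, dy_mul,
      dy_const, hx3, hy3, hxx, hxy, hyx, hyy] <;> field_simp <;> ring

end Quotient

/-- Three solutions whose 1-jets at z₀ are the standard basis give quotients X, Y whose Jacobian
matrix at z₀ is the identity. The inverse function theorem then makes (X, Y) a chart nearby. -/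
theorem exists_affine_coordinates {U : Set (ℝ × ℝ)} (hU : IsOpen U)
    {c g h d : ℝ × ℝ → ℝ} (hc : ContDiffOn ℝ ∞ c U) (hg : ContDiffOn ℝ ∞ g U)
    (hh : ContDiffOn ℝ ∞ h U) (hd : ContDiffOn ℝ ∞ d U)
    (hLT : ∀ z ∈ U, LieTresse c g h d z) {z₀ : ℝ × ℝ} (hz₀ : z₀ ∈ U) :
    ∃ (V : Set (ℝ × ℝ)) (b e X Y : ℝ × ℝ → ℝ), IsOpen V ∧ z₀ ∈ V ∧ V ⊆ U ∧
      ContDiffOn ℝ ∞ b V ∧ ContDiffOn ℝ ∞ e V ∧ ContDiffOn ℝ ∞ X V ∧ ContDiffOn ℝ ∞ Y V ∧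
      InjOn (fun z => (X z, Y z)) V ∧ ∀ z ∈ V, dx X z * dy Y z - dy X z * dx Y z ≠ 0 ∧
        FlatChristoffel (fun z => h z + 2 * e z) b c d e (fun z => g z + 2 * b z) z ∧
        IsAffineFunctionAt (fun z => h z + 2 * e z) b c d e (fun z => g z + 2 * b z) X z ∧
        IsAffineFunctionAt (fun z => h z + 2 * e z) b c d e (fun z => g z + 2 * b z) Y z := by
  obtain ⟨V₀, w₀, hV₀, hzV₀, hV₀U, hw₀, hw₀0, hw₀x, hw₀y, hH₀⟩ :=
    exists_projectiveHessian_solution hU hc hg hh hd hLT hz₀ ![1, 0, 0]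
  obtain ⟨V₁, w₁, hV₁, hzV₁, hV₁U, hw₁, hw₁0, hw₁x, hw₁y, hH₁⟩ :=
    exists_projectiveHessian_solution hU hc hg hh hd hLT hz₀ ![0, 1, 0]
  obtain ⟨V₂, w₂, hV₂, hzV₂, hV₂U, hw₂, hw₂0, hw₂x, hw₂y, hH₂⟩ :=
    exists_projectiveHessian_solution hU hc hg hh hd hLT hz₀ ![0, 0, 1]
  simp at hw₀0 hw₀x hw₀y hw₁0 hw₁x hw₁y hw₂0 hw₂x hw₂y
  set W := {z | z ∈ V₀ ∩ V₁ ∩ V₂ ∧ w₀ z ≠ 0} with hWdef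
  have hWopen : IsOpen W :=
    ((hw₀.continuousOn.mono (by intro z hz; exact hz.1.1)).isOpen_inter_preimage
      ((hV₀.inter hV₁).inter hV₂) isOpen_ne)
  have hz₀W : z₀ ∈ W := ⟨⟨⟨hzV₀, hzV₁⟩, hzV₂⟩, by rw [hw₀0]; norm_num⟩
  have hWU : W ⊆ U := fun z hz => hV₀U hz.1.1.1
  have hw₀' : ContDiffOn ℝ ∞ w₀ W := hw₀.mono fun z hz => hz.1.1.1
  have hw₁' : ContDiffOn ℝ ∞ w₁ W := hw₁.mono fun z hz => hz.1.1.2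
  have hw₂' : ContDiffOn ℝ ∞ w₂ W := hw₂.mono fun z hz => hz.1.2
  have hne : ∀ z ∈ W, w₀ z ≠ 0 := fun z hz => hz.2
  set X : ℝ × ℝ → ℝ := fun z => w₁ z / w₀ z with hXdef
  set Y : ℝ × ℝ → ℝ := fun z => w₂ z / w₀ z with hYdef
  have hX : ContDiffOn ℝ ∞ X W := hw₁'.div hw₀' hne
  have hY : ContDiffOn ℝ ∞ Y W := hw₂'.div hw₀' hne
  have hdiff : ∀ {u : ℝ × ℝ → ℝ}, ContDiffOn ℝ ∞ u W → DifferentiableAt ℝ u z₀ :=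
    fun hu => differentiableAt_of_contDiffOn hWopen hu hz₀W
  have hX1 : dx X z₀ = 1 := by
    rw [dx_div (hdiff hw₁') (hdiff hw₀') (hne _ hz₀W)]; simp [*]
  have hX2 : dy X z₀ = 0 := by
    rw [dy_div (hdiff hw₁') (hdiff hw₀') (hne _ hz₀W)]; simp [*]
  have hY1 : dx Y z₀ = 0 := by
    rw [dx_div (hdiff hw₂') (hdiff hw₀') (hne _ hz₀W)]; simp [*]
  have hY2 : dy Y z₀ = 1 := by
    rw [dy_div (hdiff hw₂') (hdiff hw₀') (hne _ hz₀W)]; simp [*]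
  have hJ : ContDiffOn ℝ ∞ (fun z => dx X z * dy Y z - dy X z * dx Y z) W :=
    ((contDiffOn_dx hWopen hX).mul (contDiffOn_dy hWopen hY)).sub
      ((contDiffOn_dy hWopen hX).mul (contDiffOn_dx hWopen hY))
  have hFs : HasStrictFDerivAt (fun z => (X z, Y z))
      ((ContinuousLinearEquiv.refl ℝ (ℝ × ℝ) : (ℝ × ℝ) ≃L[ℝ] (ℝ × ℝ)) : ℝ × ℝ →L[ℝ] ℝ × ℝ) z₀ := by
    have h1 := (hX.contDiffAt (hWopen.mem_nhds hz₀W)).hasStrictFDerivAt (by simp)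
    have h2 := (hY.contDiffAt (hWopen.mem_nhds hz₀W)).hasStrictFDerivAt (by simp)
    have e1 : fderiv ℝ X z₀ (1, 0) = 1 := hX1
    have e2 : fderiv ℝ X z₀ (0, 1) = 0 := hX2
    have e3 : fderiv ℝ Y z₀ (1, 0) = 0 := hY1
    have e4 : fderiv ℝ Y z₀ (0, 1) = 1 := hY2
    have heq : ((ContinuousLinearEquiv.refl ℝ (ℝ × ℝ) : (ℝ × ℝ) ≃L[ℝ] (ℝ × ℝ)) :
        ℝ × ℝ →L[ℝ] ℝ × ℝ) = (fderiv ℝ X z₀).prod (fderiv ℝ Y z₀) := by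
      ext <;> simp [e1, e2, e3, e4]
    rw [heq]
    exact h1.prodMk h2
  set F := hFs.toOpenPartialHomeomorph with hF
  have hFsrc : z₀ ∈ F.source := hFs.mem_toOpenPartialHomeomorph_source
  have hFinj : InjOn (fun z => (X z, Y z)) F.source := F.injOn
  set V := {z | z ∈ W ∧ dx X z * dy Y z - dy X z * dx Y z ≠ 0} ∩ F.source with hVdef
  have hVopen : IsOpen V :=
    (hJ.continuousOn.isOpen_inter_preimage hWopen isOpen_ne).inter F.open_source
  have hVW : V ⊆ W := fun z hz => hz.1.1
  refine ⟨V, fun z => dy w₀ z / w₀ z - g z / 3, fun z => dx w₀ z / w₀ z - h z / 3, X, Y,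
    hVopen, ⟨⟨hz₀W, by rw [hX1, hX2, hY1, hY2]; norm_num⟩, hFsrc⟩, hVW.trans hWU, ?_, ?_,
    hX.mono hVW, hY.mono hVW, hFinj.mono inter_subset_right, fun z hz => ⟨hz.1.2, ?_, ?_, ?_⟩⟩
  · exact (((contDiffOn_dy hWopen hw₀').div hw₀' hne).sub ((hg.mono hWU).div_const 3)).mono hVW
  · exact (((contDiffOn_dx hWopen hw₀').div hw₀' hne).sub ((hh.mono hWU).div_const 3)).mono hVW
  · exact flatChristoffel_of_projectiveHessian hWopen (hg.mono hWU) (hh.mono hWU) hw₀' hne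
      (hVW hz) (hH₀ z hz.1.1.1.1.1)
  · exact isAffineFunctionAt_div hWopen hw₁' hw₀' hne (hVW hz) (hH₁ z hz.1.1.1.1.2)
      (hH₀ z hz.1.1.1.1.1)
  · exact isAffineFunctionAt_div hWopen hw₂' hw₀' hne (hVW hz) (hH₂ z hz.1.1.1.2)
      (hH₀ z hz.1.1.1.1.1)

/-! ### The flat metric and the linearizing transformation -/

/-- The metric is dX² + dY² in affine coordinates. Its determinant is the square of the Jacobian,
and its connection is the one for which dX and dY are parallel. -/
theorem hasFlatMetricAt_of_lieTresse {U : Set (ℝ × ℝ)} (hU : IsOpen U)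
    {c g h d : ℝ × ℝ → ℝ} (hc : ContDiffOn ℝ ∞ c U) (hg : ContDiffOn ℝ ∞ g U)
    (hh : ContDiffOn ℝ ∞ h U) (hd : ContDiffOn ℝ ∞ d U)
    (hLT : ∀ z ∈ U, LieTresse c g h d z) {z₀ : ℝ × ℝ} (hz₀ : z₀ ∈ U) :
    HasFlatMetricAt U c g h d z₀ := by
  obtain ⟨V, b, e, X, Y, hV, hzV, hVU, hb, he, hX, hY, -, hall⟩ :=
    exists_affine_coordinates hU hc hg hh hd hLT hz₀
  have hXx := contDiffOn_dx hV hX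
  have hXy := contDiffOn_dy hV hX
  have hYx := contDiffOn_dx hV hY
  have hYy := contDiffOn_dy hV hY
  refine ⟨V, fun z => h z + 2 * e z, b, e, fun z => g z + 2 * b z,
    fun z => dx X z * dx X z + dx Y z * dx Y z, fun z => dx X z * dy X z + dx Y z * dy Y z,
    fun z => dy X z * dy X z + dy Y z * dy Y z, hV, hzV, hVU,
    (hh.mono hVU).add (contDiffOn_const.mul he), hb, he,
    (hg.mono hVU).add (contDiffOn_const.mul hb), (hXx.mul hXx).add (hYx.mul hYx),
    (hXx.mul hXy).add (hYx.mul hYy), (hXy.mul hXy).add (hYy.mul hYy), fun z hz => ?_⟩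
  obtain ⟨hJ, hflat, ⟨hX1, hX2, hX3⟩, ⟨hY1, hY2, hY3⟩⟩ := hall z hz
  have h1 := differentiableAt_of_contDiffOn hV hXx hz
  have h2 := differentiableAt_of_contDiffOn hV hXy hz
  have h3 := differentiableAt_of_contDiffOn hV hYx hz
  have h4 := differentiableAt_of_contDiffOn hV hYy hz
  have hX4 := dy_dx_comm hV hX hz
  have hY4 := dy_dx_comm hV hY hz
  refine ⟨by ring, by ring, hflat, ?_, ?_⟩
  · have h5 : (dx X z * dx X z + dx Y z * dx Y z) * (dy X z * dy X z + dy Y z * dy Y z)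
        - (dx X z * dy X z + dx Y z * dy Y z) ^ 2
        = (dx X z * dy Y z - dy X z * dx Y z) ^ 2 := by ring
    simp only [h5]
    exact pow_ne_zero 2 hJ
  · refine ⟨?_, ?_, ?_, ?_, ?_, ?_⟩ <;>
      simp (disch := fun_prop) only [dx_add, dx_mul, dy_add, dy_mul, hX4, hY4, hX1, hX2, hX3,
        hY1, hY2, hY3] <;> ring

/-- With the second derivatives of X and Y expressed through the connection, the transformed second
derivative is the geodesic equation times the Jacobian over a cube of the slope factor. Hence both
equations have the same zeros wherever the chart is nondegenerate. -/
theorem newSecond_eq {V : Set (ℝ × ℝ)} (hV : IsOpen V) {a b c d e f X Y : ℝ × ℝ → ℝ} {z : ℝ × ℝ}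
    (hz : z ∈ V) (hX : ContDiffOn ℝ ∞ X V) (hY : ContDiffOn ℝ ∞ Y V)
    (hXa : IsAffineFunctionAt a b c d e f X z) (hYa : IsAffineFunctionAt a b c d e f Y z)
    {p : ℝ} (hp : slopeDeriv X z p ≠ 0) (q : ℝ) :
    newSecond X Y z p q = (dx X z * dy Y z - dy X z * dx Y z) *
      (q - (-(c z) * p ^ 3 + (f z - 2 * b z) * p ^ 2 - (a z - 2 * e z) * p + d z))
        / slopeDeriv X z p ^ 3 := by
  obtain ⟨hX1, hX2, hX3⟩ := hXa
  obtain ⟨hY1, hY2, hY3⟩ := hYa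
  have h1 := differentiableAt_of_contDiffOn hV (contDiffOn_dx hV hX) hz
  have h2 := differentiableAt_of_contDiffOn hV (contDiffOn_dy hV hX) hz
  have h3 := differentiableAt_of_contDiffOn hV (contDiffOn_dx hV hY) hz
  have h4 := differentiableAt_of_contDiffOn hV (contDiffOn_dy hV hY) hz
  have hX4 := dy_dx_comm hV hX hz
  have hY4 := dy_dx_comm hV hY hz
  have hp' : dx X z + p * dy X z ≠ 0 := hp
  have hderiv : deriv (newFirst X Y z) p = (dy Y z * (dx X z + p * dy X z)
      - (dx Y z + p * dy Y z) * dy X z) / (dx X z + p * dy X z) ^ 2 := by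
    have hl : ∀ r s : ℝ, HasDerivAt (fun t => r + t * s) s p := fun r s => by
      simpa using ((hasDerivAt_id p).mul_const s).const_add r
    exact ((hl (dx Y z) (dy Y z)).fun_div (hl (dx X z) (dy X z)) hp').deriv
  unfold newSecond totalDeriv
  rw [hderiv]
  unfold newFirst slopeDeriv
  rw [dx_div (by fun_prop) (by fun_prop) hp', dy_div (by fun_prop) (by fun_prop) hp']
  simp (disch := fun_prop) only [dx_add, dx_mul, dx_const, dy_add, dy_mul, dy_const, hX4, hY4,
    hX1, hX2, hX3, hY1, hY2, hY3]
  field_simp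
  ring

theorem linearizableAt_of_lieTresse {U : Set (ℝ × ℝ)} (hU : IsOpen U)
    {c g h d : ℝ × ℝ → ℝ} (hc : ContDiffOn ℝ ∞ c U) (hg : ContDiffOn ℝ ∞ g U)
    (hh : ContDiffOn ℝ ∞ h U) (hd : ContDiffOn ℝ ∞ d U)
    (hLT : ∀ z ∈ U, LieTresse c g h d z) {z₀ : ℝ × ℝ} (hz₀ : z₀ ∈ U) :
    LinearizableAt U (rootRHS c g h d) z₀ := by
  obtain ⟨V, b, e, X, Y, hV, hzV, hVU, hb, he, hX, hY, hinj, hall⟩ :=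
    exists_affine_coordinates hU hc hg hh hd hLT hz₀
  refine ⟨V, X, Y, hV, hzV, hVU, hX, hY, hinj, fun z hz => (hall z hz).1,
    fun z hz p q hp => ?_⟩
  obtain ⟨hJ, -, hXa, hYa⟩ := hall z hz
  rw [newSecond_eq hV hz hX hY hXa hYa hp q, div_eq_zero_iff, or_iff_left (pow_ne_zero 3 hp),
    mul_eq_zero, or_iff_right hJ, sub_eq_zero]
  simp only [rootRHS, add_sub_cancel_right]

/-! ### Functions of `(x, y)` and `y'` -/

section TotalDerivative

variable {F Q : ℝ × ℝ → ℝ → ℝ} {z : ℝ × ℝ} {p : ℝ}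

/-- As a single Fréchet derivative in the direction (1, p, q), the total derivative obeys the chain
rule along curves and inherits smoothness. -/
theorem totalDeriv_eq_fderiv (hF : DifferentiableAt ℝ (Function.uncurry F) (z, p)) (q : ℝ) :
    totalDeriv F z p q = fderiv ℝ (Function.uncurry F) (z, p) ((1, p), q) := by
  have h1 : HasFDerivAt (fun w => F w p) (fderiv ℝ (Function.uncurry F) (z, p) ∘L
      ContinuousLinearMap.inl ℝ (ℝ × ℝ) ℝ) z :=
    HasFDerivAt.comp (g := Function.uncurry F) (f := fun w => (w, p)) z hF.hasFDerivAt
      (hasFDerivAt_prodMk_left z p)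
  have h2 : HasDerivAt (F z) (fderiv ℝ (Function.uncurry F) (z, p) (0, 1)) p :=
    hF.hasFDerivAt.comp_hasDerivAt p ((hasDerivAt_const p z).prodMk (hasDerivAt_id p))
  have h3 : (((1, p), q) : (ℝ × ℝ) × ℝ) = ((1, 0), 0) + p • ((0, 1), 0) + q • (0, 1) := by
    ext <;> simp
  rw [totalDeriv, dx, dy, h1.fderiv, h2.deriv, h3, map_add, map_add, map_smul, map_smul]
  simp

theorem hasDerivAt_along_curve {y : ℝ → ℝ} {x : ℝ}
    (hF : DifferentiableAt ℝ (Function.uncurry F) ((x, y x), deriv y x))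
    (hy : DifferentiableAt ℝ y x) (hy' : DifferentiableAt ℝ (deriv y) x) :
    HasDerivAt (fun t => F (t, y t) (deriv y t))
      (totalDeriv F (x, y x) (deriv y x) (deriv (deriv y) x)) x := by
  rw [totalDeriv_eq_fderiv hF]
  exact hF.hasFDerivAt.comp_hasDerivAt x
    (((hasDerivAt_id x).prodMk hy.hasDerivAt).prodMk hy'.hasDerivAt)

/-- Differentiating a second-order equation twice along its solutions. -/
theorem isSolution_four_of_isSolution_two {U : Set (ℝ × ℝ)} (hU : IsOpen U)
    (hQ : ContDiffOn ℝ ∞ (Function.uncurry Q) (U ×ˢ univ))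
    (hT : ContDiffOn ℝ ∞ (Function.uncurry (totalDerivAlong Q Q)) (U ×ˢ univ))
    {I : Set ℝ} {y : ℝ → ℝ} (hy : IsSolution 2 U Q I y) :
    IsSolution 4 U (totalDerivAlong Q (totalDerivAlong Q Q)) I y := by
  obtain ⟨hI, hyc, hsol⟩ := hy
  have hn : ∀ n : ℕ, (n : WithTop ℕ∞) ≤ ∞ := fun n => by exact_mod_cast le_top
  have hopen : IsOpen (U ×ˢ (univ : Set ℝ)) := hU.prod isOpen_univ
  have hy2 : EqOn (deriv (deriv y)) (fun x => Q (x, y x) (deriv y x)) I := fun x hx => by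
    have h1 := (hsol x hx).2
    rwa [iteratedDeriv_succ, iteratedDeriv_one] at h1
  -- Each pass through y'' = Q(x, y, y') gains one derivative; two passes lead from C² to C⁴.
  have hstep : ∀ n : ℕ, ContDiffOn ℝ ((n + 2 : ℕ) : WithTop ℕ∞) y I →
      ContDiffOn ℝ ((n + 3 : ℕ) : WithTop ℕ∞) y I := by
    intro n hyn
    have hyn' : ContDiffOn ℝ ((n + 1 : ℕ) + 1 : WithTop ℕ∞) y I := by exact_mod_cast hyn
    rw [contDiffOn_succ_iff_deriv_of_isOpen hI] at hyn'
    have hder := hyn'.2.2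
    have hcurve : ContDiffOn ℝ ((n + 1 : ℕ) : WithTop ℕ∞) (fun x => ((x, y x), deriv y x)) I :=
      (contDiffOn_id.prodMk (hyn.of_le (by exact_mod_cast Nat.le_succ _))).prodMk hder
    have hcomp : ContDiffOn ℝ ((n + 1 : ℕ) : WithTop ℕ∞) (fun x => Q (x, y x) (deriv y x)) I :=
      (hQ.of_le (hn (n + 1))).comp hcurve fun x hx => ⟨(hsol x hx).1, mem_univ _⟩
    have hder2 : ContDiffOn ℝ ((n + 1 : ℕ) + 1 : WithTop ℕ∞) (deriv y) I := by
      rw [contDiffOn_succ_iff_deriv_of_isOpen hI]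
      refine ⟨hder.differentiableOn (by simp), by simp, hcomp.congr hy2⟩
    have : ContDiffOn ℝ ((n + 1 : ℕ) + 1 + 1 : WithTop ℕ∞) y I := by
      rw [contDiffOn_succ_iff_deriv_of_isOpen hI]
      exact ⟨hyn'.1, by simp, hder2⟩
    exact_mod_cast this
  have hy4 : ContDiffOn ℝ ((4 : ℕ) : WithTop ℕ∞) y I := hstep 1 (hstep 0 hyc)
  have hyd : ∀ x ∈ I, DifferentiableAt ℝ y x := fun x hx =>
    (hy4.contDiffAt (hI.mem_nhds hx)).differentiableAt (by simp)
  have hyd' : ∀ x ∈ I, DifferentiableAt ℝ (deriv y) x := fun x hx => by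
    have hyn' : ContDiffOn ℝ ((3 : ℕ) + 1 : WithTop ℕ∞) y I := by exact_mod_cast hy4
    rw [contDiffOn_succ_iff_deriv_of_isOpen hI] at hyn'
    exact (hyn'.2.2.contDiffAt (hI.mem_nhds hx)).differentiableAt (by simp)
  have hdiff : ∀ {F : ℝ × ℝ → ℝ → ℝ}, ContDiffOn ℝ ∞ (Function.uncurry F) (U ×ˢ univ) →
      ∀ x ∈ I, DifferentiableAt ℝ (Function.uncurry F) ((x, y x), deriv y x) := fun hF x hx =>
    (hF.contDiffAt (hopen.mem_nhds ⟨(hsol x hx).1, mem_univ _⟩)).differentiableAt (by simp)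
  have halong : ∀ {F : ℝ × ℝ → ℝ → ℝ} {k : ℕ},
      ContDiffOn ℝ ∞ (Function.uncurry F) (U ×ˢ univ) →
      EqOn (iteratedDeriv k y) (fun x => F (x, y x) (deriv y x)) I →
      EqOn (iteratedDeriv (k + 1) y)
        (fun x => totalDerivAlong Q F (x, y x) (deriv y x)) I := by
    intro F k hF hk x hx
    rw [iteratedDeriv_succ, (hk.eventuallyEq_of_mem (hI.mem_nhds hx)).deriv_eq,
      (hasDerivAt_along_curve (hdiff hF x hx) (hyd x hx) (hyd' x hx)).deriv, hy2 hx]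
    rfl
  exact ⟨hI, hy4, fun x hx => ⟨(hsol x hx).1,
    halong hT (halong hQ fun x hx => (hsol x hx).2) hx⟩⟩

end TotalDerivative

/-! ### Total derivatives -/

/-- A function whose derivative in the last variable is constant is affine in that variable. -/
theorem fderiv_eq_of_vertical_fderiv_eq_const {A : Type*} [NormedAddCommGroup A] [NormedSpace ℝ A]
    {f : A × ℝ → ℝ} {S : Set A} (hS : IsOpen S) {k : ℝ}
    (hf : DifferentiableOn ℝ f (S ×ˢ univ))
    (hk : ∀ a ∈ S, ∀ t, fderiv ℝ f (a, t) (0, 1) = k) :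
    DifferentiableOn ℝ (fun a => f (a, 0)) S ∧ ∀ a ∈ S, ∀ t s v,
      fderiv ℝ f (a, t) (v, s) = fderiv ℝ (fun a => f (a, 0)) a v + k * s := by
  have hopen : IsOpen (S ×ˢ (univ : Set ℝ)) := hS.prod isOpen_univ
  have hfd : ∀ a ∈ S, ∀ t, DifferentiableAt ℝ f (a, t) := fun a ha t =>
    hf.differentiableAt (hopen.mem_nhds ⟨ha, mem_univ _⟩)
  have hd0 : ∀ a ∈ S, DifferentiableAt ℝ (fun a => f (a, 0)) a := fun a ha =>
    (hfd a ha 0).comp a (differentiableAt_id.prodMk (differentiableAt_const _))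
  -- The fibre is all of ℝ, so a function with vanishing derivative along it is constant there.
  have haff : ∀ a ∈ S, ∀ t, f (a, t) = f (a, 0) + k * t := by
    intro a ha t
    have hder : ∀ t, HasDerivAt (fun t => f (a, t) - k * t) 0 t := fun t => by
      have h1 : HasDerivAt (fun t => f (a, t)) (fderiv ℝ f (a, t) (0, 1)) t :=
        (hfd a ha t).hasFDerivAt.comp_hasDerivAt t
          ((hasDerivAt_const t a).prodMk (hasDerivAt_id t))
      rw [hk a ha t] at h1
      simpa using h1.fun_sub ((hasDerivAt_id' t).const_mul k)
    have := is_const_of_deriv_eq_zero (fun t => (hder t).differentiableAt)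
      (fun t => (hder t).deriv) t 0
    simp only [mul_zero, sub_zero] at this
    linarith
  refine ⟨fun a ha => (hd0 a ha).differentiableWithinAt, fun a ha t s v => ?_⟩
  have heq : f =ᶠ[𝓝 (a, t)] fun w => f (w.1, 0) + k * w.2 := by
    filter_upwards [hopen.mem_nhds (show (a, t) ∈ S ×ˢ univ from ⟨ha, mem_univ _⟩)] with w hw
    exact haff w.1 hw.1 w.2
  have hfst : HasFDerivAt (fun w : A × ℝ => f (w.1, 0))
      (fderiv ℝ (fun a => f (a, 0)) a ∘L ContinuousLinearMap.fst ℝ A ℝ) (a, t) :=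
    HasFDerivAt.comp (g := fun a => f (a, 0)) (f := Prod.fst) (a, t) (hd0 a ha).hasFDerivAt
      hasFDerivAt_fst
  rw [heq.fderiv_eq, (hfst.fun_add (hasFDerivAt_snd.const_mul k)).fderiv]
  simp

/-- If `y'''' + G (x, y) y'` is a total derivative, then `G` is affine in `y'`. -/
theorem affine_of_isTotalDerivativeOn {V : Set (ℝ × ℝ)} (hV : IsOpen V) {G : ℝ × ℝ → ℝ → ℝ}
    (h : IsTotalDerivativeOn V G) {z : ℝ × ℝ} (hz : z ∈ V) (p : ℝ) :
    G z p = G z 0 + p * (G z 1 - G z 0) := by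
  obtain ⟨Φ, hΦ, hG⟩ := h
  -- Reassociates the jet variables so that the one to be eliminated is always the last factor.
  let L : (((ℝ × ℝ) × ℝ) × ℝ) × ℝ →L[ℝ] ℝ × ℝ × ℝ × ℝ × ℝ :=
    let π := ContinuousLinearMap.fst ℝ (((ℝ × ℝ) × ℝ) × ℝ) ℝ
    let π' := ContinuousLinearMap.fst ℝ ((ℝ × ℝ) × ℝ) ℝ ∘L π
    let π'' := ContinuousLinearMap.fst ℝ (ℝ × ℝ) ℝ ∘L π'
    (ContinuousLinearMap.fst ℝ ℝ ℝ ∘L π'').prod <| (ContinuousLinearMap.snd ℝ ℝ ℝ ∘L π'').prod <|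
      (ContinuousLinearMap.snd ℝ (ℝ × ℝ) ℝ ∘L π').prod <|
      (ContinuousLinearMap.snd ℝ ((ℝ × ℝ) × ℝ) ℝ ∘L π).prod <|
      ContinuousLinearMap.snd ℝ (((ℝ × ℝ) × ℝ) × ℝ) ℝ
  have hL : ∀ x y p q r, L ((((x, y), p), q), r) = (x, y, p, q, r) := fun _ _ _ _ _ => rfl
  have hV₁ : IsOpen (V ×ˢ (univ : Set ℝ)) := hV.prod isOpen_univ
  have hV₂ : IsOpen ((V ×ˢ (univ : Set ℝ)) ×ˢ (univ : Set ℝ)) := hV₁.prod isOpen_univ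
  have hD : IsOpen {w : ℝ × ℝ × ℝ × ℝ × ℝ | (w.1, w.2.1) ∈ V} :=
    hV.preimage (by fun_prop : Continuous fun w : ℝ × ℝ × ℝ × ℝ × ℝ => (w.1, w.2.1))
  have hΨd : DifferentiableOn ℝ (Φ ∘ L) (((V ×ˢ univ) ×ˢ univ) ×ˢ univ) :=
    hΦ.comp L.differentiable.differentiableOn fun w hw => hw.1.1.1
  have hΨ : ∀ z ∈ V, ∀ p q r s,
      fderiv ℝ (Φ ∘ L) (((z, p), q), r) ((((1, p), q), r), s) = s + G z p := by
    rintro ⟨x, y⟩ hz p q r s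
    have hat : DifferentiableAt ℝ Φ (L ((((x, y), p), q), r)) :=
      hΦ.differentiableAt (hD.mem_nhds hz)
    rw [fderiv_comp _ hat L.differentiableAt, L.fderiv]
    exact hG x y p q r s hz
  -- The identity is linear in y''''. Subtracting its cases y'''' = 1 and y'''' = 0 isolates the
  -- derivative in y'''; the same device then serves for y'' and y'.
  have hr : ∀ a ∈ (V ×ˢ (univ : Set ℝ)) ×ˢ (univ : Set ℝ), ∀ t,
      fderiv ℝ (Φ ∘ L) (a, t) (0, 1) = 1 := by
    rintro ⟨⟨z, p⟩, q⟩ ⟨⟨hz, -⟩, -⟩ t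
    have h1 : (0, 1) = ((((((1 : ℝ), p), q), t), (1 : ℝ)) : (((ℝ × ℝ) × ℝ) × ℝ) × ℝ)
        - ((((1, p), q), t), 0) := by simp
    rw [h1, map_sub, hΨ z hz, hΨ z hz]
    ring
  obtain ⟨hd₁, hf₁⟩ := fderiv_eq_of_vertical_fderiv_eq_const hV₂ hΨd hr
  set Ψ₁ : ((ℝ × ℝ) × ℝ) × ℝ → ℝ := fun a => (Φ ∘ L) (a, 0)
  have hΨ₁ : ∀ z ∈ V, ∀ p q r, fderiv ℝ Ψ₁ ((z, p), q) (((1, p), q), r) = G z p := by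
    intro z hz p q r
    have h1 := hf₁ ((z, p), q) ⟨⟨hz, mem_univ _⟩, mem_univ _⟩ r 0 (((1, p), q), r)
    rw [hΨ z hz] at h1
    linarith
  have hq : ∀ a ∈ V ×ˢ (univ : Set ℝ), ∀ t, fderiv ℝ Ψ₁ (a, t) (0, 1) = 0 := by
    rintro ⟨z, p⟩ ⟨hz, -⟩ t
    have h1 : (0, 1) = (((((1 : ℝ), p), t), (1 : ℝ)) : ((ℝ × ℝ) × ℝ) × ℝ)
        - (((1, p), t), 0) := by simp
    rw [h1, map_sub, hΨ₁ z hz, hΨ₁ z hz, sub_self]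
  obtain ⟨hd₂, hf₂⟩ := fderiv_eq_of_vertical_fderiv_eq_const hV₁ hd₁ hq
  set Ψ₂ : (ℝ × ℝ) × ℝ → ℝ := fun a => Ψ₁ (a, 0)
  have hΨ₂ : ∀ z ∈ V, ∀ p q, fderiv ℝ Ψ₂ (z, p) ((1, p), q) = G z p := by
    intro z hz p q
    have h1 := hf₂ (z, p) ⟨hz, mem_univ _⟩ q 0 ((1, p), q)
    rw [hΨ₁ z hz] at h1
    linarith
  have hp : ∀ a ∈ V, ∀ t, fderiv ℝ Ψ₂ (a, t) (0, 1) = 0 := by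
    intro z hz t
    have h1 : (0, 1) = ((((1 : ℝ), t), (1 : ℝ)) : (ℝ × ℝ) × ℝ) - ((1, t), 0) := by simp
    rw [h1, map_sub, hΨ₂ z hz, hΨ₂ z hz, sub_self]
  obtain ⟨-, hf₃⟩ := fderiv_eq_of_vertical_fderiv_eq_const hV hd₂ hp
  have hΨ₃ : ∀ p, fderiv ℝ (fun a => Ψ₂ (a, 0)) z (1, p) = G z p := by
    intro p
    have h1 := hf₃ z hz p 0 (1, p)
    rw [hΨ₂ z hz] at h1
    linarith
  -- A function of (x, y) alone is left; its derivative along (1, p) is affine in p and fixed by p =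
  -- 0 and p = 1.
  have h1 : ((1, p) : ℝ × ℝ) = (1, 0) + p • ((1, 1) - (1, 0)) := by ext <;> simp
  rw [← hΨ₃ p, h1, map_add, map_smul, map_sub, hΨ₃, hΨ₃, smul_eq_mul]

/-- A polynomial of degree seven in `y'` is not affine in `y'`. -/
theorem not_isTotalDerivativeOn_septic {V : Set (ℝ × ℝ)} (hV : IsOpen V)
    {P : Fin 8 → ℝ × ℝ → ℝ} {z : ℝ × ℝ} (hz : z ∈ V) (h7 : P 7 z ≠ 0) :
    ¬ IsTotalDerivativeOn V (septic P) := by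
  intro h
  have haff := affine_of_isTotalDerivativeOn hV h hz
  -- The difference from the affine interpolant vanishes at 0 and 1 anyway. With 2, ..., 7 it has
  -- eight zeros but degree at most seven, so its leading coefficient vanishes.
  have h2 := haff 2
  have h3 := haff 3
  have h4 := haff 4
  have h5 := haff 5
  have h6 := haff 6
  have h7' := haff 7
  simp only [septic] at h2 h3 h4 h5 h6 h7'
  apply h7
  linarith

/-! ### Two differentiations along the root equation -/

section RootEquation

variable {U : Set (ℝ × ℝ)} {c g h d : ℝ × ℝ → ℝ} {z : ℝ × ℝ}

theorem contDiffOn_uncurry_rootRHS (hc : ContDiffOn ℝ ∞ c U) (hg : ContDiffOn ℝ ∞ g U)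
    (hh : ContDiffOn ℝ ∞ h U) (hd : ContDiffOn ℝ ∞ d U) :
    ContDiffOn ℝ ∞ (Function.uncurry (rootRHS c g h d)) (U ×ˢ univ) := by
  have hfst : ∀ {f : ℝ × ℝ → ℝ}, ContDiffOn ℝ ∞ f U →
      ContDiffOn ℝ ∞ (fun w : (ℝ × ℝ) × ℝ => f w.1) (U ×ˢ univ) := fun hf =>
    hf.comp contDiffOn_fst fun w hw => hw.1
  have hsnd : ContDiffOn ℝ ∞ (fun w : (ℝ × ℝ) × ℝ => w.2) (U ×ˢ univ) := contDiffOn_snd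
  exact ((((hfst hc).neg.mul (hsnd.pow 3)).add ((hfst hg).mul (hsnd.pow 2))).sub
    ((hfst hh).mul hsnd)).add (hfst hd)

theorem deriv_rootRHS (p : ℝ) :
    deriv (rootRHS c g h d z) p = -(3 * c z * p ^ 2) + 2 * g z * p - h z := by
  have h1 := ((((hasDerivAt_pow 3 p).const_mul (-(c z))).fun_add
    ((hasDerivAt_pow 2 p).const_mul (g z))).fun_sub ((hasDerivAt_id' p).const_mul (h z))).add_const
      (d z)
  rw [show rootRHS c g h d z
    = fun p => -(c z) * p ^ 3 + g z * p ^ 2 - h z * p + d z from rfl, h1.deriv]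
  norm_num
  ring

/-- Squares of coefficients are written as products so that `dx_mul` and `dy_mul` can differentiate
the formula again. -/
theorem totalDerivAlong_rootRHS (hU : IsOpen U) (hc : ContDiffOn ℝ ∞ c U)
    (hg : ContDiffOn ℝ ∞ g U) (hh : ContDiffOn ℝ ∞ h U) (hd : ContDiffOn ℝ ∞ d U) (hz : z ∈ U)
    (p : ℝ) :
    totalDerivAlong (rootRHS c g h d) (rootRHS c g h d) z p =
      3 * (c z * c z) * p ^ 5 + (-(dy c z) - 5 * (c z * g z)) * p ^ 4
        + (-(dx c z) + dy g z + 4 * (c z * h z) + 2 * (g z * g z)) * p ^ 3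
        + (dx g z - dy h z - 3 * (g z * h z) - 3 * (c z * d z)) * p ^ 2
        + (-(dx h z) + dy d z + h z * h z + 2 * (d z * g z)) * p + (dx d z - d z * h z) := by
  have hc' := differentiableAt_of_contDiffOn hU hc hz
  have hg' := differentiableAt_of_contDiffOn hU hg hz
  have hh' := differentiableAt_of_contDiffOn hU hh hz
  have hd' := differentiableAt_of_contDiffOn hU hd hz
  rw [totalDerivAlong, totalDeriv, deriv_rootRHS]
  unfold rootRHS
  simp (disch := fun_prop) only [dx_add, dx_sub, dx_mul, dx_neg, dx_const, dy_add, dy_sub, dy_mul,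
    dy_neg, dy_const]
  ring

theorem contDiffOn_uncurry_totalDerivAlong_rootRHS (hU : IsOpen U) (hc : ContDiffOn ℝ ∞ c U)
    (hg : ContDiffOn ℝ ∞ g U) (hh : ContDiffOn ℝ ∞ h U) (hd : ContDiffOn ℝ ∞ d U) :
    ContDiffOn ℝ ∞ (Function.uncurry (totalDerivAlong (rootRHS c g h d) (rootRHS c g h d)))
      (U ×ˢ univ) := by
  have hopen : IsOpen (U ×ˢ (univ : Set ℝ)) := hU.prod isOpen_univ
  have hQ := contDiffOn_uncurry_rootRHS hc hg hh hd
  have hfd := ((contDiffOn_infty_iff_fderiv_of_isOpen hopen).1 hQ).2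
  have hdir : ContDiffOn ℝ ∞ (fun w : (ℝ × ℝ) × ℝ =>
      (((1 : ℝ), w.2), Function.uncurry (rootRHS c g h d) w)) (U ×ˢ univ) :=
    (contDiffOn_const.prodMk contDiffOn_snd).prodMk hQ
  refine (hfd.clm_apply hdir).congr fun w hw => ?_
  exact totalDeriv_eq_fderiv ((hQ.contDiffAt (hopen.mem_nhds hw)).differentiableAt (by simp)) _

/-- Comparison of the eight coefficients in p: `h7` to `h4` are the definitions of c, g, h, d solved
for P₇, ..., P₄, and the constraints supply the rest. -/
theorem totalDerivAlong_totalDerivAlong_rootRHS (hU : IsOpen U) (hc : ContDiffOn ℝ ∞ c U)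
    (hg : ContDiffOn ℝ ∞ g U) (hh : ContDiffOn ℝ ∞ h U) (hd : ContDiffOn ℝ ∞ d U) (hz : z ∈ U)
    {P : Fin 8 → ℝ × ℝ → ℝ} (h7 : P 7 z = 15 * c z ^ 3)
    (h6 : P 6 z = 35 * c z ^ 2 * g z + 10 * c z * dy c z)
    (h5 : P 5 z = 27 * c z ^ 2 * h z + 26 * g z ^ 2 * c z - 9 * c z * dx c z
      + 9 * g z * dy c z + 8 * c z * dy g z + dy (dy c) z)
    (h4 : P 4 z = 21 * c z ^ 2 * d z + 38 * g z * h z * c z + 6 * g z ^ 3 - 8 * g z * dx c z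
      + 8 * h z * dy c z - 7 * c z * dx g z + 7 * g z * dy g z + 6 * c z * dy h z
      - 2 * dx (dy c) z + dy (dy g) z)
    (hcon : Constraints P c g h d z) (p : ℝ) :
    -septic P z p = totalDerivAlong (rootRHS c g h d)
      (totalDerivAlong (rootRHS c g h d) (rootRHS c g h d)) z p := by
  obtain ⟨h3, h2, h1, h0⟩ := hcon
  have hT := fun w (hw : w ∈ U) => totalDerivAlong_rootRHS hU hc hg hh hd hw
  have hder : deriv (totalDerivAlong (rootRHS c g h d) (rootRHS c g h d) z) p =
      15 * (c z * c z) * p ^ 4 + 4 * (-(dy c z) - 5 * (c z * g z)) * p ^ 3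
        + 3 * (-(dx c z) + dy g z + 4 * (c z * h z) + 2 * (g z * g z)) * p ^ 2
        + 2 * (dx g z - dy h z - 3 * (g z * h z) - 3 * (c z * d z)) * p
        + (-(dx h z) + dy d z + h z * h z + 2 * (d z * g z)) := by
    rw [funext (hT z hz)]
    have hpoly := ((((((hasDerivAt_pow 5 p).const_mul (3 * (c z * c z))).fun_add
      ((hasDerivAt_pow 4 p).const_mul (-(dy c z) - 5 * (c z * g z)))).fun_add
      ((hasDerivAt_pow 3 p).const_mul
        (-(dx c z) + dy g z + 4 * (c z * h z) + 2 * (g z * g z)))).fun_add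
      ((hasDerivAt_pow 2 p).const_mul
        (dx g z - dy h z - 3 * (g z * h z) - 3 * (c z * d z)))).fun_add
      ((hasDerivAt_id' p).const_mul
        (-(dx h z) + dy d z + h z * h z + 2 * (d z * g z)))).add_const (dx d z - d z * h z)
    rw [hpoly.deriv]
    norm_num
    ring
  have hc' := differentiableAt_of_contDiffOn hU hc hz
  have hg' := differentiableAt_of_contDiffOn hU hg hz
  have hh' := differentiableAt_of_contDiffOn hU hh hz
  have hd' := differentiableAt_of_contDiffOn hU hd hz
  have hcx := differentiableAt_of_contDiffOn hU (contDiffOn_dx hU hc) hz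
  have hcy := differentiableAt_of_contDiffOn hU (contDiffOn_dy hU hc) hz
  have hgx := differentiableAt_of_contDiffOn hU (contDiffOn_dx hU hg) hz
  have hgy := differentiableAt_of_contDiffOn hU (contDiffOn_dy hU hg) hz
  have hhx := differentiableAt_of_contDiffOn hU (contDiffOn_dx hU hh) hz
  have hhy := differentiableAt_of_contDiffOn hU (contDiffOn_dy hU hh) hz
  have hdx := differentiableAt_of_contDiffOn hU (contDiffOn_dx hU hd) hz
  have hdy := differentiableAt_of_contDiffOn hU (contDiffOn_dy hU hd) hz
  rw [totalDerivAlong, totalDeriv, hder,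
    dx_congr hU (fun w hw => hT w hw p) hz, dy_congr hU (fun w hw => hT w hw p) hz]
  simp (disch := fun_prop) only [dx_add, dx_sub, dx_mul, dx_neg, dx_const, dy_add, dy_sub, dy_mul,
    dy_neg, dy_const, dy_dx_comm hU hc hz, dy_dx_comm hU hg hz, dy_dx_comm hU hh hz,
    dy_dx_comm hU hd hz]
  simp only [septic, rootRHS, h7, h6, h5, h4, h3, h2, h1, h0]
  ring

end RootEquation

/-! ### The coefficients of the root equation -/

theorem cbrt_pow_three (t : ℝ) : cbrt t ^ 3 = t := by
  have h1 : (|t| ^ (1 / 3 : ℝ)) ^ 3 = |t| := by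
    rw [← Real.rpow_natCast, ← Real.rpow_mul (abs_nonneg t)]
    norm_num
  rcases lt_trichotomy t 0 with ht | rfl | ht
  · rw [cbrt, mul_pow, h1, Real.sign_of_neg ht, abs_of_neg ht]; ring
  · simp [cbrt]
  · rw [cbrt, mul_pow, h1, Real.sign_of_pos ht, abs_of_pos ht]; ring

theorem contDiffAt_cbrt {t : ℝ} (ht : t ≠ 0) : ContDiffAt ℝ ∞ cbrt t := by
  rcases lt_or_gt_of_ne ht with h | h
  · have h1 : ContDiffAt ℝ ∞ (fun s : ℝ => -(-s) ^ (1 / 3 : ℝ)) t :=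
      (contDiffAt_id.neg.rpow_const_of_ne (by simpa using ht)).neg
    refine h1.congr_of_eventuallyEq ?_
    filter_upwards [Iio_mem_nhds h] with s hs
    rw [cbrt, Real.sign_of_neg hs, abs_of_neg hs]; ring
  · have h1 : ContDiffAt ℝ ∞ (fun s : ℝ => s ^ (1 / 3 : ℝ)) t :=
      contDiffAt_id.rpow_const_of_ne ht
    refine h1.congr_of_eventuallyEq ?_
    filter_upwards [Ioi_mem_nhds h] with s hs
    rw [cbrt, Real.sign_of_pos hs, abs_of_pos hs]; ring

section Coefficients

variable {U : Set (ℝ × ℝ)} {P : Fin 8 → ℝ × ℝ → ℝ}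

theorem septic_leading_eq (P : Fin 8 → ℝ × ℝ → ℝ) (z : ℝ × ℝ) : P 7 z = 15 * coeffC P z ^ 3 := by
  rw [coeffC, cbrt_pow_three]; ring

theorem contDiffOn_coeffC (hP : ∀ i, ContDiffOn ℝ ∞ (P i) U)
    (hc : ∀ z ∈ U, coeffC P z ≠ 0) : ContDiffOn ℝ ∞ (coeffC P) U := by
  intro z hz
  have h7 : P 7 z / 15 ≠ 0 := fun h => hc z hz (by simp [coeffC, h, cbrt])
  exact (contDiffAt_cbrt h7).comp_contDiffWithinAt z ((hP 7).div_const 15 z hz)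

theorem contDiffOn_coeffG (hU : IsOpen U) (hP : ∀ i, ContDiffOn ℝ ∞ (P i) U)
    (hc : ∀ z ∈ U, coeffC P z ≠ 0) : ContDiffOn ℝ ∞ (coeffG P) U := by
  have h1 := contDiffOn_coeffC hP hc
  have h2 := contDiffOn_dy hU h1
  have h3 := hP 6
  have hi : ContDiffOn ℝ ∞ (fun z => (coeffC P z)⁻¹) U := h1.inv hc
  -- Quotients by c become products with c⁻¹, which is smooth as c ≠ 0; h and d are treated in the
  -- same way.
  have : ContDiffOn ℝ ∞ (fun z => P 6 z * ((coeffC P z)⁻¹ * (coeffC P z)⁻¹) / 35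
      - 2 * dy (coeffC P) z * (coeffC P z)⁻¹ / 7) U := by fun_prop
  refine this.congr fun z hz => ?_
  have := hc z hz
  simp only [coeffG]
  field_simp

theorem contDiffOn_coeffH (hU : IsOpen U) (hP : ∀ i, ContDiffOn ℝ ∞ (P i) U)
    (hc : ∀ z ∈ U, coeffC P z ≠ 0) : ContDiffOn ℝ ∞ (coeffH P) U := by
  have h1 := contDiffOn_coeffC hP hc
  have h2 := contDiffOn_coeffG hU hP hc
  have h3 := hP 5
  have h4 := contDiffOn_dx hU h1
  have h5 := contDiffOn_dy hU h1
  have h6 := contDiffOn_dy hU h2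
  have h7 := contDiffOn_dy hU h5
  have hi : ContDiffOn ℝ ∞ (fun z => (coeffC P z)⁻¹) U := h1.inv hc
  have : ContDiffOn ℝ ∞ (fun z => ((P 5 z / 27 - coeffG P z * dy (coeffC P) z / 3
      - dy (dy (coeffC P)) z / 27) * (coeffC P z)⁻¹ - 26 * (coeffG P z * coeffG P z) / 27
      + dx (coeffC P) z / 3 - 8 * dy (coeffG P) z / 27) * (coeffC P z)⁻¹) U := by fun_prop
  refine this.congr fun z hz => ?_
  have := hc z hz
  simp only [coeffH]
  field_simp
  ring

theorem contDiffOn_coeffD (hU : IsOpen U) (hP : ∀ i, ContDiffOn ℝ ∞ (P i) U)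
    (hc : ∀ z ∈ U, coeffC P z ≠ 0) : ContDiffOn ℝ ∞ (coeffD P) U := by
  have h1 := contDiffOn_coeffC hP hc
  have h2 := contDiffOn_coeffG hU hP hc
  have h3 := contDiffOn_coeffH hU hP hc
  have h4 := hP 4
  have h5 := contDiffOn_dx hU h1
  have h6 := contDiffOn_dy hU h1
  have h7 := contDiffOn_dx hU h2
  have h8 := contDiffOn_dy hU h2
  have h9 := contDiffOn_dy hU h3
  have h10 := contDiffOn_dx hU h6
  have h11 := contDiffOn_dy hU h8
  have hi : ContDiffOn ℝ ∞ (fun z => (coeffC P z)⁻¹) U := h1.inv hc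
  have : ContDiffOn ℝ ∞ (fun z => ((P 4 z / 21 - 2 * (coeffG P z * coeffG P z * coeffG P z) / 7
      + 8 * coeffG P z * dx (coeffC P) z / 21 - 8 * coeffH P z * dy (coeffC P) z / 21
      - coeffG P z * dy (coeffG P) z / 3 + 2 * dx (dy (coeffC P)) z / 21
      - dy (dy (coeffG P)) z / 21) * (coeffC P z)⁻¹ - 38 * coeffG P z * coeffH P z / 21
      + dx (coeffG P) z / 3 - 2 * dy (coeffH P) z / 7) * (coeffC P z)⁻¹) U := by fun_prop
  refine this.congr fun z hz => ?_
  have := hc z hz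
  simp only [coeffD]
  field_simp
  ring

end Coefficients

end CondLin

end

/-! ### The three assertions combined -/

theorem theorem1 (U : Set (ℝ × ℝ)) (hU : IsOpen U) (P : Fin 8 → ℝ × ℝ → ℝ)
    (hP : ∀ i, ContDiffOn ℝ ∞ (P i) U)
    (hc : ∀ z ∈ U, CondLin.coeffC P z ≠ 0)
    (hconstraints : ∀ z ∈ U, CondLin.Constraints P (CondLin.coeffC P) (CondLin.coeffG P)
      (CondLin.coeffH P) (CondLin.coeffD P) z)
    (hLieTresse : ∀ z ∈ U, CondLin.LieTresse (CondLin.coeffC P) (CondLin.coeffG P)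
      (CondLin.coeffH P) (CondLin.coeffD P) z) :
    CondLin.ConditionallyLinearizable U (fun z p => -CondLin.septic P z p)
      (CondLin.rootRHS (CondLin.coeffC P) (CondLin.coeffG P)
        (CondLin.coeffH P) (CondLin.coeffD P)) ∧
    (∀ V ⊆ U, IsOpen V → V.Nonempty →
      ¬ CondLin.IsTotalDerivativeOn V (CondLin.septic P)) ∧
    (∀ z ∈ U, CondLin.HasFlatMetricAt U (CondLin.coeffC P) (CondLin.coeffG P)
      (CondLin.coeffH P) (CondLin.coeffD P) z) := by
  have hcs := CondLin.contDiffOn_coeffC hP hc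
  have hgs := CondLin.contDiffOn_coeffG hU hP hc
  have hhs := CondLin.contDiffOn_coeffH hU hP hc
  have hds := CondLin.contDiffOn_coeffD hU hP hc
  have hseptic : ∀ z ∈ U, ∀ p : ℝ, -CondLin.septic P z p =
      CondLin.totalDerivAlong (CondLin.rootRHS (CondLin.coeffC P) (CondLin.coeffG P)
        (CondLin.coeffH P) (CondLin.coeffD P))
        (CondLin.totalDerivAlong (CondLin.rootRHS (CondLin.coeffC P) (CondLin.coeffG P)
          (CondLin.coeffH P) (CondLin.coeffD P)) (CondLin.rootRHS (CondLin.coeffC P)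
          (CondLin.coeffG P) (CondLin.coeffH P) (CondLin.coeffD P))) z p := by
    intro z hz p
    have hc0 := hc z hz
    refine CondLin.totalDerivAlong_totalDerivAlong_rootRHS hU hcs hgs hhs hds hz
      (CondLin.septic_leading_eq P z) ?_ ?_ ?_ (hconstraints z hz) p
    -- Clearing the powers of c turns the definitions of g, h and d into formulas for P₆, P₅ and P₄.
    · simp only [CondLin.coeffG]
      field_simp
      ring
    · simp only [CondLin.coeffH]
      field_simp
      ring
    · simp only [CondLin.coeffD]
      field_simp
      ring
  refine ⟨⟨hseptic, fun I y hy => ?_, fun z hz =>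
    CondLin.linearizableAt_of_lieTresse hU hcs hgs hhs hds hLieTresse hz⟩,
    fun V hVU hV hne => ?_, fun z hz =>
    CondLin.hasFlatMetricAt_of_lieTresse hU hcs hgs hhs hds hLieTresse hz⟩
  · obtain ⟨hI, hy4, hsol⟩ := CondLin.isSolution_four_of_isSolution_two hU
      (CondLin.contDiffOn_uncurry_rootRHS hcs hgs hhs hds)
      (CondLin.contDiffOn_uncurry_totalDerivAlong_rootRHS hU hcs hgs hhs hds) hy
    exact ⟨hI, hy4, fun x hx => ⟨(hsol x hx).1,
      (hsol x hx).2.trans (hseptic _ (hsol x hx).1 _).symm⟩⟩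
  · obtain ⟨z, hz⟩ := hne
    refine CondLin.not_isTotalDerivativeOn_septic hV hz ?_
    rw [CondLin.septic_leading_eq P z]
    exact mul_ne_zero (by norm_num) (pow_ne_zero 3 (hc z (hVU hz)))
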